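/- Let $I_1,I_2,I_3\subset\mathbb R$ be non-empty open intervals, let $D=\{(u,v,w): u\in I_1,\ v\in I_2,\ w\in I_3,\ 2w+v-u\ne 0\}$, and put $1/\rho=w+\tfrac12(v-u)$. Consider the system $$u_t=(v+w)u_x,\qquad v_t=(u-w)v_x,\qquad w_t=\tfrac12(u+v)w_x. \qquad (1)$$ Under the change of variables $u=-c+s-1/\rho$, $v=-c-s+1/\rho$, $w=s$ it is equivalent to the gas-dynamics equations $\rho_t+(\rho c)_x=0$, $c_t+cc_x+\rho^{-1}P_x=0$, $s_t+cs_x=0$ with $P=s-1/\rho$. For smooth functions $f(u)$, $\varphi(v)$, $\psi(w)$ on $I_1,I_2,I_3$ put $S=\frac12[f(u)+\varphi(v)+4\psi(w)]$ and $$w^1=-\tfrac12(2w+v-u)f'(u)-S,\quad w^2=\tfrac12(2w+v-u)\varphi'(v)-S,\quad w^3=(2w+v-u)\psi'(w)-S ,$$ and let $J_{f,\varphi,\psi}$ be the operator $$J=\frac{4}{\rho^2}\,\mathrm{diag}(f,\varphi,\psi)\frac{d}{dx} +\frac2\rho\begin{pmatrix}\frac1\rho f'u_x+2f(\frac1\rho)_x&-\varphi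 u_x-fv_x&-2\psi u_x-fw_x\\ \varphi u_x+fv_x&\frac1\rho\varphi'v_x+2\varphi(\frac1\rho)_x&-2\psi v_x+\varphi w_x\\ 2\psi u_x+fw_x&2\psi v_x-\varphi w_x&\frac1\rho\psi'w_x+2\psi(\frac1\rho)_x\end{pmatrix} +\begin{pmatrix}w^1u_x&u_x\\w^2v_x&v_x\\w^3w_x&w_x\end{pmatrix}\Big(\frac{d}{dx}\Big)^{-1} \begin{pmatrix}u_x&v_x&w_x\\w^1u_x&w^2v_x&w^3w_x\end{pmatrix}$$ on smooth fields $x\mapsto(u,v,w)\in D$. Then: 1. Every $J_{f,\varphi,\psi}$ is a Hamiltonian operator (skew-adjoint, with the Jacobi identity for the corresponding bracket), the flow $u_\tau=w^1u_x$, $v_\tau=w^2v_x$, $w_\tau=w^3w_x$ commutes with (1), all these operators are mutually compatible (linear combinations of any two are Hamiltonian), and different triples $(f,\varphi,\psi)$ give different operators. In particular there are infinitely many of them, including infinitely many with a nondegenerate metric (2) that is not flat. 2. If $f,\varphi,\psi$ have no zeros, then the local part of $J_{f,\varphi,\psi}$ is $g^{ij}\frac{d}{dx}-g^{is}\Gamma^j_{sk}u^k_x$,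 where $\Gamma$ is the Levi-Civita connection of the conformally flat metric $$(2w+v-u)^{-2}\left(\frac{du^2}{f(u)}+\frac{dv^2}{\varphi(v)}+\frac{dw^2}{\psi(w)}\right),\qquad (2)$$ and (1) is the Hamiltonian system $u^i_t=J^{ij}\,\partial h/\partial u^j$ with the density $h=\frac\rho8\big(\big[\int^u\frac{d\nu}{\sqrt{f(\nu)}}\big]^2-\big[\int^v\frac{d\nu}{\sqrt{\varphi(\nu)}}\big]^2\big)$, for any choice of the primitives (for a negative function $f$, $[\int d\nu/\sqrt{f}]^2$ means $-[\int d\nu/\sqrt{|f|}]^2$, and likewise for $\varphi$). Here $(d/dx)^{-1}$ of a total derivative $\frac{d}{dx}q(u,v,w)$ is $q(u,v,w)$ for a suitable choice of the additive constant in $q$. 3. If $f,\varphi,\psi$ have no zeros, the metric (2) is flat on $D$ if and only if $$f(u)=\varepsilon u+\alpha,\qquad \varphi(v)=-\varepsilon v+\beta,\qquad \psi(w)=-\tfrac{\varepsilon}{2}w+\gamma$$ for some constants $\varepsilon,\alpha,\beta,\gamma$ with $\alpha+\beta+4\gamma=0$. In this case $w^1=w^2=w^3=0$ on $D$, so that $J_{f,\varphi,\psi}$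 equals its local part; this local operator is Hamiltonian, and (1) is Hamiltonian with respect to it for some density. If $I_1,I_2,I_3$ are bounded, the local operators obtained in this way (with $f,\varphi,\psi$ without zeros) contain three linearly independent ones, and all of them are linear combinations of these three. -/

import Mathlib

open scoped ContDiff

noncomputable section

namespace HydroType

/-- Points `(u, v, w)` of the three-dimensional space of dependent variables. -/
abbrev Pt := Fin 3 → ℝ

/-- Partial derivative `∂F/∂u^k` at `p`. -/
def pd (k : Fin 3) (F : Pt → ℝ) (p : Pt) : ℝ :=
  fderiv ℝ F p (Pi.single k 1)

/-! ### Metrics, Levi-Civita connection, curvature -/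

/-- Christoffel symbols `Γ^k_{ij}` of the covariant metric `g`. -/
def christoffel (g : Pt → Matrix (Fin 3) (Fin 3) ℝ) (k i j : Fin 3) (p : Pt) : ℝ :=
  (1 / 2) * ∑ l, (g p)⁻¹ k l *
    (pd i (fun q => g q l j) p + pd j (fun q => g q l i) p - pd l (fun q => g q i j) p)

/-- Riemann curvature tensor `R^i_{jkl}` of the covariant metric `g`. -/
def riemann (g : Pt → Matrix (Fin 3) (Fin 3) ℝ) (i j k l : Fin 3) (p : Pt) : ℝ :=
  pd k (christoffel g i l j) p - pd l (christoffel g i k j) p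
    + ∑ m, (christoffel g i k m p * christoffel g m l j p
        - christoffel g i l m p * christoffel g m k j p)

/-- The metric `g` is flat on `D`. -/
def IsFlatOn (g : Pt → Matrix (Fin 3) (Fin 3) ℝ) (D : Set Pt) : Prop :=
  ∀ p ∈ D, ∀ i j k l, riemann g i j k l p = 0

/-- The metric `g` is conformally flat on `D`: near every point some smooth positive multiple
of it is flat. -/
def IsConformallyFlatOn (g : Pt → Matrix (Fin 3) (Fin 3) ℝ) (D : Set Pt) : Prop :=
  ∀ p ∈ D, ∃ V : Set Pt, IsOpen V ∧ p ∈ V ∧ V ⊆ D ∧ ∃ c : Pt → ℝ,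
    ContDiffOn ℝ ∞ c V ∧ (∀ q ∈ V, 0 < c q) ∧ IsFlatOn (fun q => c q • g q) V

/-! ### Fields, test covectors, operators -/

/-- A smooth field `x ↦ u(x)` with values in `D` (no condition at infinity). -/
def IsField (D : Set Pt) (u : ℝ → Pt) : Prop :=
  ContDiff ℝ ∞ u ∧ ∀ x, u x ∈ D

/-- A smooth compactly supported covector field along the line. -/
def IsTest (ξ : ℝ → Pt) : Prop :=
  ContDiff ℝ ∞ ξ ∧ HasCompactSupport ξ

/-- An operator depending on the field `u`, `T u ξ = J_u ξ`. -/
abbrev Op := (ℝ → Pt) → (ℝ → Pt) → (ℝ → Pt)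

/-- The bivector `∫ ξ_i (J_u η)^i dx`, that is, the bracket `{F_ξ, F_η}` at `u` of the
functionals `F_ξ[u] = ∫ ξ_i u^i dx` and `F_η[u] = ∫ η_i u^i dx`. -/
def pairing (T : Op) (u ξ η : ℝ → Pt) : ℝ :=
  ∫ x, ∑ i, ξ x i * T u η x i

/-- `T` is a Hamiltonian operator on the fields with values in `D`: it is skew-adjoint and the
bracket `{F, G} = ∫ (δF/δu) J (δG/δu) dx` satisfies the Jacobi identity (vanishing of the
Schouten trivector, `⟨ξ, J'[Jζ]η⟩ + cyclic = 0` for all `u` and all test covectors, where `J'[X]`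
is the derivative of `J` in the direction `X` of the field). -/
def IsHamiltonian (D : Set Pt) (T : Op) : Prop :=
  ∀ u, IsField D u →
    (∀ ξ, IsTest ξ → ContDiff ℝ ∞ (T u ξ)) ∧
    (∀ ξ η, IsTest ξ → IsTest η → pairing T u ξ η = -pairing T u η ξ) ∧
    ∀ ξ η ζ, IsTest ξ → IsTest η → IsTest ζ → ∃ a b c : ℝ,
      HasDerivAt (fun ε : ℝ => pairing T (fun x => u x + ε • T u ζ x) ξ η) a 0 ∧
      HasDerivAt (fun ε : ℝ => pairing T (fun x => u x + ε • T u ξ x) η ζ) b 0 ∧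
      HasDerivAt (fun ε : ℝ => pairing T (fun x => u x + ε • T u η x) ζ ξ) c 0 ∧
      a + b + c = 0

/-- Compatibility: all linear combinations are Hamiltonian operators. -/
def AreCompatible (D : Set Pt) (T T' : Op) : Prop :=
  ∀ c c' : ℝ, IsHamiltonian D (c • T + c' • T')

/-- The operator `T` as an honest family: one linear map on test covectors for each field. Two
operators are the same on `D` when their restrictions are equal. -/
def restrict (D : Set Pt) (T : Op) :
    {u : ℝ → Pt // IsField D u} → {ξ : ℝ → Pt // IsTest ξ} → ℝ → Pt :=
  fun u ξ => T u.1 ξ.1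

/-- The skew-symmetric inverse of `d/dx`. -/
def Dinv (s : ℝ → ℝ) (x : ℝ) : ℝ :=
  (1 / 2) * ((∫ y in Set.Iic x, s y) - ∫ y in Set.Ioi x, s y)

/-- The coefficients of an operator of hydrodynamic type
`J^{ij} = g^{ij}(u) d/dx + b^{ij}(u; u_x) + ∑_α L_α^i(u) u^i_x (d/dx)⁻¹ R_α^j(u) u^j_x`
with finitely many nonlocal terms given by diagonal affinors `L_α`, `R_α`. -/
structure HydroOp where
  /-- the contravariant metric `g^{ij}` -/
  metric : Pt → Matrix (Fin 3) (Fin 3) ℝ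
  /-- the term `b^{ij}(u; u_x)` of order zero; the second argument is `u_x` -/
  conn : Pt → Pt → Matrix (Fin 3) (Fin 3) ℝ
  /-- the number of nonlocal terms -/
  N : ℕ
  left : Fin N → Pt → Pt
  right : Fin N → Pt → Pt

namespace HydroOp

/-- The value of `J` on `ξ` when `K_α` is taken for `(d/dx)⁻¹ (R_α^j u^j_x ξ_j)`. -/
def act (J : HydroOp) (u ξ : ℝ → Pt) (K : Fin J.N → ℝ → ℝ) (x : ℝ) : Pt := fun i =>
  (∑ j, (J.metric (u x) i j * deriv ξ x j + J.conn (u x) (deriv u x) i j * ξ x j))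
    + ∑ α, J.left α (u x) i * deriv u x i * K α x

/-- The operator on test covectors, with the skew-symmetric `(d/dx)⁻¹`. -/
def toOp (J : HydroOp) : Op := fun u ξ =>
  J.act u ξ (fun α => Dinv (fun y => ∑ j, J.right α (u y) j * deriv u y j * ξ y j))

/-- The local part `g^{ij} d/dx + b^{ij}(u; u_x)`. -/
def localPart (J : HydroOp) : HydroOp where
  metric := J.metric
  conn := J.conn
  N := 0
  left := fun _ => 0
  right := fun _ => 0

/-- The local part of `J` is `g^{ij} d/dx - g^{is} Γ^j_{sk} u^k_x` for the Levi-Civita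
connection of the covariant metric `g`. -/
def IsGeneratedBy (J : HydroOp) (g : Pt → Matrix (Fin 3) (Fin 3) ℝ) (D : Set Pt) : Prop :=
  ∀ p ∈ D, IsUnit (g p).det ∧ (g p).IsSymm ∧ J.metric p = (g p)⁻¹ ∧
    ∀ (X : Pt) (i j : Fin 3),
      J.conn p X i j = -∑ s, ∑ k, (g p)⁻¹ i s * christoffel g j s k p * X k

end HydroOp

/-- The right-hand side `V^i(u) u^i_x` of the diagonal system `u^i_t = V^i(u) u^i_x`. -/
def flow (V : Pt → Pt) (u : ℝ → Pt) (x : ℝ) : Pt := fun i => V (u x) i * deriv u x i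

/-- The diagonal systems `u^i_t = V^i u^i_x` and `u^i_τ = W^i u^i_x` commute on `D`,
`u_{tτ} = u_{τt}`. -/
def FlowsCommute (D : Set Pt) (V W : Pt → Pt) : Prop :=
  ∀ u, IsField D u → ∀ x i, ∃ d : ℝ,
    HasDerivAt (fun ε : ℝ => flow V (fun y => u y + ε • flow W u y) x i) d 0 ∧
    HasDerivAt (fun ε : ℝ => flow W (fun y => u y + ε • flow V u y) x i) d 0

/-- The system `u^i_t = V^i(u) u^i_x` is `u_t = J ∂h/∂u` with the density `h(u)`. The expressions
`R_α^j u^j_x ∂h/∂u^j` are total derivatives of functions `q_α(u)`, and these are the values of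
`(d/dx)⁻¹` on them. -/
def IsHamiltonianSystem (D : Set Pt) (V : Pt → Pt) (J : HydroOp) (h : Pt → ℝ) : Prop :=
  ContDiffOn ℝ ∞ h D ∧ ∃ q : Fin J.N → Pt → ℝ,
    (∀ α, ContDiffOn ℝ ∞ (q α) D ∧ ∀ p ∈ D, ∀ k, pd k (q α) p = J.right α p k * pd k h p) ∧
    ∀ u, IsField D u → ∀ x,
      flow V u x = J.act u (fun y k => pd k h (u y)) (fun α y => q α (u y)) x

/-! ### The system `u_t = (v+w) u_x`, `v_t = (u-w) v_x`, `w_t = (u+v) w_x / 2` -/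

/-- Characteristic speeds of the system. -/
def speed (p : Pt) : Pt := ![p 1 + p 2, p 0 - p 2, (p 0 + p 1) / 2]

/-- The function `2w + v - u`, which is `2/ρ`. -/
def b (p : Pt) : ℝ := 2 * p 2 + p 1 - p 0

/-- The domain: `u ∈ I 0`, `v ∈ I 1`, `w ∈ I 2` and `2w + v - u ≠ 0`. -/
def dom (I : Fin 3 → Set ℝ) : Set Pt := {p | (∀ i, p i ∈ I i) ∧ b p ≠ 0}

/-- Parameters `f = F 0`, `φ = F 1`, `ψ = F 2`: smooth functions on the intervals `I i`. -/
def IsParam (I : Fin 3 → Set ℝ) (F : Fin 3 → ℝ → ℝ) : Prop :=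
  ∀ i, ContDiffOn ℝ ∞ (F i) (I i)

/-- Parameters without zeros, for which the metric is defined and nondegenerate. -/
def IsNondegParam (I : Fin 3 → Set ℝ) (F : Fin 3 → ℝ → ℝ) : Prop :=
  IsParam I F ∧ ∀ i, ∀ s ∈ I i, F i s ≠ 0

/-- The metric `(2w+v-u)⁻² (du²/f(u) + dv²/φ(v) + dw²/ψ(w))`. -/
def gasMetric (F : Fin 3 → ℝ → ℝ) (p : Pt) : Matrix (Fin 3) (Fin 3) ℝ :=
  Matrix.diagonal fun i => ((b p) ^ 2)⁻¹ * (F i (p i))⁻¹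

/-- The speeds `w¹, w², w³` of the nonlocal tail. -/
def tailSpeed (F : Fin 3 → ℝ → ℝ) (p : Pt) : Pt :=
  let S := (F 0 (p 0) + F 1 (p 1) + 4 * F 2 (p 2)) / 2
  ![-(b p / 2) * deriv (F 0) (p 0) - S,
    b p / 2 * deriv (F 1) (p 1) - S,
    b p * deriv (F 2) (p 2) - S]

/-- The nonlocal operator with the parameters `f, φ, ψ`. -/
def gasOp (F : Fin 3 → ℝ → ℝ) : HydroOp where
  metric p := Matrix.diagonal fun i => (b p) ^ 2 * F i (p i)
  conn p X :=
    let f := F 0 (p 0)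
    let φ := F 1 (p 1)
    let ψ := F 2 (p 2)
    let f' := deriv (F 0) (p 0)
    let φ' := deriv (F 1) (p 1)
    let ψ' := deriv (F 2) (p 2)
    let r := b p / 2
    let r_x := X 2 + (X 1 - X 0) / 2
    (b p) • !![r * f' * X 0 + 2 * f * r_x, -φ * X 0 - f * X 1, -2 * ψ * X 0 - f * X 2;
               φ * X 0 + f * X 1, r * φ' * X 1 + 2 * φ * r_x, -2 * ψ * X 1 + φ * X 2;
               2 * ψ * X 0 + f * X 2, 2 * ψ * X 1 - φ * X 2, r * ψ' * X 2 + 2 * ψ * r_x]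
  N := 2
  left := ![tailSpeed F, fun _ _ => 1]
  right := ![fun _ _ => 1, tailSpeed F]

/-- The density `(ρ/8) ([∫ du/√f]² - [∫ dv/√φ]²)`, `ρ = 2/(2w+v-u)`, where `A` and `B` are
primitives of `1/√|f|` and `1/√|φ|`; where `f < 0` the square of `∫ du/√f` is `-A²`. -/
def gasDensity (F : Fin 3 → ℝ → ℝ) (A B : ℝ → ℝ) (p : Pt) : ℝ :=
  (2 / b p) / 8 *
    (Real.sign (F 0 (p 0)) * A (p 0) ^ 2 - Real.sign (F 1 (p 1)) * B (p 1) ^ 2)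

/-- `f = εu + α`, `φ = -εv + β`, `ψ = -εw/2 + γ` with `α + β + 4γ = 0`. -/
def IsFlatParam (I : Fin 3 → Set ℝ) (F : Fin 3 → ℝ → ℝ) : Prop :=
  ∃ ε α β γ : ℝ, α + β + 4 * γ = 0 ∧
    (∀ s ∈ I 0, F 0 s = ε * s + α) ∧
    (∀ s ∈ I 1, F 1 s = -ε * s + β) ∧
    (∀ s ∈ I 2, F 2 s = -(ε / 2) * s + γ)

/-! ### Gas dynamics: functions of `z = (t, x)` -/

/-- `∂F/∂t` -/
def dt (F : ℝ × ℝ → ℝ) (z : ℝ × ℝ) : ℝ := fderiv ℝ F z (1, 0)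

/-- `∂F/∂x` -/
def dx (F : ℝ × ℝ → ℝ) (z : ℝ × ℝ) : ℝ := fderiv ℝ F z (0, 1)

/-- The equations of non-isentropic gas dynamics with pressure `P = s - 1/ρ` at `z`. -/
def GasEquations (ρ c s : ℝ × ℝ → ℝ) (z : ℝ × ℝ) : Prop :=
  dt ρ z + dx (fun y => ρ y * c y) z = 0 ∧
  dt c z + c z * dx c z + 1 / ρ z * dx (fun y => s y - 1 / ρ y) z = 0 ∧
  dt s z + c z * dx s z = 0

/-- The system in Riemann invariants at `z`. -/
def RiemannEquations (U : Fin 3 → ℝ × ℝ → ℝ) (z : ℝ × ℝ) : Prop :=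
  ∀ i, dt (U i) z = speed (fun j => U j z) i * dx (U i) z

end HydroType

end

open HydroType

/-!
The coefficients `a = (-1, 1, 2)` of `b = 2w + v - u` govern everything. With
`K = (d/dx)⁻¹ (u^j_x ξ_j)` and the transformed covector `ξ̂_i = b ξ_i + a_i K`, the operator
becomes `(J ξ)^i = b (F_i ξ̂_i' + ½ (F_i)_x ξ̂_i) + u^i_x T`, where
`T' = -∑ a_j (F_j ξ̂_j' + ½ (F_j)_x ξ̂_j)`. In the transformed covectors the bracket is thus that
of the three uncoupled scalar operators `F_i d/dx + ½ (F_i)_x`, which gives skewness and, after an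
integration by parts of the variation of `ξ̂`, the Jacobi identity. As the operator is linear in
the parameters, compatibility costs nothing.

The curvature of the metric is `R^{ij}_{ij} = w^i + w^j`. So flatness means `w = 0`, and this
forces `F_i'` to be constant multiples of `a_i`. Finally, `h = (α(u) - β(v)) / b` is a density of
the system if and only if `f α'' + ½ f' α' = φ β'' + ½ φ' β'` is a constant (here `2`); the squares
of the primitives of `|f|^{-1/2}` and `|φ|^{-1/2}`, with the right signs, solve these equations.
-/

open MeasureTheory Filter Topology

namespace HydroType

section Dinv

variable {s t : ℝ → ℝ}

lemma Dinv_eq (hs : Integrable s) (x : ℝ) :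
    Dinv s x = (∫ y in Set.Iic 0, s y) + (∫ y in (0 : ℝ)..x, s y) - (1 / 2) * ∫ y, s y := by
  have hdiff : (∫ y in Set.Iic x, s y) - ∫ y in Set.Iic 0, s y = ∫ y in (0 : ℝ)..x, s y :=
    intervalIntegral.integral_Iic_sub_Iic hs.integrableOn hs.integrableOn
  have hsum : (∫ y in Set.Iic x, s y) + ∫ y in Set.Ioi x, s y = ∫ y, s y :=
    intervalIntegral.integral_Iic_add_Ioi hs.integrableOn hs.integrableOn
  unfold Dinv
  linarith

lemma hasDerivAt_Dinv (hc : Continuous s) (hs : Integrable s) (x : ℝ) :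
    HasDerivAt (Dinv s) (s x) x := by
  rw [funext (Dinv_eq hs)]
  exact ((hc.integral_hasStrictDerivAt 0 x).hasDerivAt.const_add _).sub_const _

lemma contDiff_Dinv (hc : ContDiff ℝ ∞ s) (hs : Integrable s) : ContDiff ℝ ∞ (Dinv s) := by
  have hderiv := hasDerivAt_Dinv hc.continuous hs
  rw [contDiff_infty_iff_deriv, funext fun x => (hderiv x).deriv]
  exact ⟨fun x => (hderiv x).differentiableAt, hc⟩

lemma Dinv_add (hs : Integrable s) (ht : Integrable t) (x : ℝ) :
    Dinv (fun y => s y + t y) x = Dinv s x + Dinv t x := by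
  unfold Dinv
  rw [integral_add hs.integrableOn ht.integrableOn, integral_add hs.integrableOn ht.integrableOn]
  ring

lemma Dinv_const_mul (c : ℝ) (s : ℝ → ℝ) (x : ℝ) : Dinv (fun y => c * s y) x = c * Dinv s x := by
  unfold Dinv
  rw [integral_const_mul, integral_const_mul]
  ring

lemma Dinv_sum {ι : Type*} [Fintype ι] {s : ι → ℝ → ℝ} (hs : ∀ m, Integrable (s m)) (x : ℝ) :
    Dinv (fun y => ∑ m, s m y) x = ∑ m, Dinv (s m) x := by
  unfold Dinv
  rw [integral_finsetSum _ fun m _ => (hs m).integrableOn,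
    integral_finsetSum _ fun m _ => (hs m).integrableOn, ← Finset.sum_sub_distrib, Finset.mul_sum]

lemma Dinv_neg_eq_neg {R : ℝ} (h : ∀ x ∉ Set.Ioo (-R) R, s x = 0) :
    Dinv s (-R) = -Dinv s R := by
  have left_tail : ∫ y in Set.Iic (-R), s y = 0 :=
    setIntegral_eq_zero_of_forall_eq_zero fun x hx => h x fun hx' => absurd hx'.1 (not_lt.2 hx)
  have right_tail : ∫ y in Set.Ioi R, s y = 0 :=
    setIntegral_eq_zero_of_forall_eq_zero fun x hx => h x fun hx' => absurd hx'.2 (not_lt.2 hx.le)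
  have left_full : ∫ y in Set.Iic R, s y = ∫ y, s y :=
    setIntegral_eq_integral_of_forall_compl_eq_zero fun x hx => h x fun hx' => hx hx'.2.le
  have right_full : ∫ y in Set.Ioi (-R), s y = ∫ y, s y :=
    setIntegral_eq_integral_of_forall_compl_eq_zero fun x hx => h x fun hx' => hx hx'.1
  unfold Dinv
  rw [left_tail, right_tail, left_full, right_full]
  ring

end Dinv

/-! ### The diagonal form of the operator -/

section DiagonalForm

/-- The coefficients `a = (-1, 1, 2)` of the linear form `b = 2w + v - u`. -/
def bCoeff : Fin 3 → ℝ := ![-1, 1, 2]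

lemma b_eq_sum (p : Pt) : b p = ∑ i, bCoeff i * p i := by
  simp only [b, bCoeff, Fin.sum_univ_three, Matrix.cons_val]
  ring

/-- The sum `S = ½ (f + φ + 4ψ)`, in the form `½ ∑ a_i² F_i` with the coefficients `a` of `b`. -/
noncomputable def paramSum (F : Fin 3 → ℝ → ℝ) (p : Pt) : ℝ :=
  (1 / 2) * ∑ i, bCoeff i ^ 2 * F i (p i)

lemma tailSpeed_eq (F : Fin 3 → ℝ → ℝ) (p : Pt) (i : Fin 3) :
    tailSpeed F p i = b p / 2 * bCoeff i * deriv (F i) (p i) - paramSum F p := by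
  fin_cases i <;> simp [tailSpeed, paramSum, bCoeff, Fin.sum_univ_three] <;> ring

/-- The nonlocal quantity `K = (d/dx)⁻¹ (u^j_x ξ_j)`. -/
noncomputable def momentum (u ξ : ℝ → Pt) : ℝ → ℝ := Dinv fun y => ∑ j, deriv u y j * ξ y j

/-- The nonlocal quantity `H = (d/dx)⁻¹ (w^j u^j_x ξ_j)`. -/
noncomputable def weightedMomentum (F : Fin 3 → ℝ → ℝ) (u ξ : ℝ → Pt) : ℝ → ℝ :=
  Dinv fun y => ∑ j, tailSpeed F (u y) j * deriv u y j * ξ y j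

/-- The transformed covector `ξ̂_i = b ξ_i + a_i K`, in which the operator becomes diagonal. -/
noncomputable def hat (u ξ : ℝ → Pt) (i : Fin 3) (x : ℝ) : ℝ :=
  b (u x) * ξ x i + bCoeff i * momentum u ξ x

/-- The derivative of `hat u ξ i`; it is local in `u` and `ξ`. -/
noncomputable def hatDeriv (u ξ : ℝ → Pt) (i : Fin 3) (x : ℝ) : ℝ :=
  b (deriv u x) * ξ x i + b (u x) * deriv ξ x i + bCoeff i * ∑ j, deriv u x j * ξ x j

/-- The scalar operator `F_i d/dx + ½ (F_i)_x`, applied to the transformed covector. -/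
noncomputable def scalarPart (F : Fin 3 → ℝ → ℝ) (u ξ : ℝ → Pt) (i : Fin 3) (x : ℝ) : ℝ :=
  F i (u x i) * hatDeriv u ξ i x + (1 / 2) * (deriv (F i) (u x i) * deriv u x i) * hat u ξ i x

/-- The coefficient `T` of `u_x`, the generator of translations, in the diagonal form
`b · scalarPart + T u_x` of the operator. -/
noncomputable def translationCoeff (F : Fin 3 → ℝ → ℝ) (u ξ : ℝ → Pt) (x : ℝ) : ℝ :=
  weightedMomentum F u ξ x + paramSum F (u x) * momentum u ξ x
    - ∑ j, bCoeff j * F j (u x j) * hat u ξ j x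

lemma act_gasOp (F : Fin 3 → ℝ → ℝ) (u ξ : ℝ → Pt) (K : Fin 2 → ℝ → ℝ) (x : ℝ) (i : Fin 3) :
    (gasOp F).act u ξ K x i =
      b (u x) * (F i (u x i) * (b (deriv u x) * ξ x i + b (u x) * deriv ξ x i
          + bCoeff i * ∑ j, deriv u x j * ξ x j)
        + (1 / 2) * (deriv (F i) (u x i) * deriv u x i) * (b (u x) * ξ x i + bCoeff i * K 0 x))
      + deriv u x i * (K 1 x + paramSum F (u x) * K 0 x
        - ∑ j, bCoeff j * F j (u x j) * (b (u x) * ξ x j + bCoeff j * K 0 x)) := by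
  have hb : b (deriv u x) = 2 * deriv u x 2 + deriv u x 1 - deriv u x 0 := rfl
  unfold HydroOp.act
  change _ + ∑ α : Fin 2, _ = _
  rw [Fin.sum_univ_two]
  fin_cases i <;>
  simp [gasOp, Fin.sum_univ_three, tailSpeed_eq, paramSum, bCoeff, Matrix.diagonal, hb] <;> ring

lemma toOp_gasOp_eq_act (F : Fin 3 → ℝ → ℝ) (u ξ : ℝ → Pt) :
    (gasOp F).toOp u ξ = (gasOp F).act u ξ ![momentum u ξ, weightedMomentum F u ξ] := by
  unfold HydroOp.toOp
  congr 1
  funext α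
  change Fin 2 at α
  fin_cases α
  · simp [gasOp, momentum]
  · rfl

lemma toOp_gasOp (F : Fin 3 → ℝ → ℝ) (u ξ : ℝ → Pt) (x : ℝ) (i : Fin 3) :
    (gasOp F).toOp u ξ x i
      = b (u x) * scalarPart F u ξ i x + deriv u x i * translationCoeff F u ξ x := by
  rw [toOp_gasOp_eq_act, act_gasOp]
  rfl

end DiagonalForm

/-! ### Smoothness -/

section Smoothness

variable {I : Fin 3 → Set ℝ} {F : Fin 3 → ℝ → ℝ} {u ξ : ℝ → Pt}

lemma contDiff_b : ContDiff ℝ ∞ b := by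
  unfold b
  fun_prop

lemma isOpen_dom (hI : ∀ i, IsOpen (I i)) : IsOpen (dom I) := by
  have hdom : dom I = (⋂ i, (fun p : Pt => p i) ⁻¹' I i) ∩ b ⁻¹' {0}ᶜ := by
    ext p
    simp [dom]
  rw [hdom]
  exact (isOpen_iInter_of_finite fun i => (hI i).preimage (continuous_apply i)).inter
    (isOpen_compl_singleton.preimage contDiff_b.continuous)

lemma contDiff_of_forall_tsupport {E : Type*} [NormedAddCommGroup E] [NormedSpace ℝ E]
    {n : WithTop ℕ∞} {f : ℝ → E} (h : ∀ x ∈ tsupport f, ContDiffAt ℝ n f x) : ContDiff ℝ n f := by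
  rw [contDiff_iff_contDiffAt]
  intro x
  by_cases hx : x ∈ tsupport f
  · exact h x hx
  · exact contDiffAt_const.congr_of_eventuallyEq (notMem_tsupport_iff_eventuallyEq.1 hx)

lemma IsParam.contDiffAt (hI : ∀ i, IsOpen (I i)) (hF : IsParam I F) {i : Fin 3} {s : ℝ}
    (hs : s ∈ I i) : ContDiffAt ℝ ∞ (F i) s :=
  (hF i).contDiffAt ((hI i).mem_nhds hs)

lemma IsParam.contDiffAt_deriv (hI : ∀ i, IsOpen (I i)) (hF : IsParam I F) {i : Fin 3} {s : ℝ}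
    (hs : s ∈ I i) : ContDiffAt ℝ ∞ (deriv (F i)) s :=
  ((contDiffOn_infty_iff_deriv_of_isOpen (hI i)).1 (hF i)).2.contDiffAt ((hI i).mem_nhds hs)

lemma IsParam.hasDerivAt (hI : ∀ i, IsOpen (I i)) (hF : IsParam I F) {i : Fin 3} {s : ℝ}
    (hs : s ∈ I i) : HasDerivAt (F i) (deriv (F i) s) s :=
  ((hF.contDiffAt hI hs).differentiableAt (by simp)).hasDerivAt

lemma contDiff_component (hu : ContDiff ℝ ∞ u) (i : Fin 3) : ContDiff ℝ ∞ fun y => u y i :=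
  contDiff_pi.1 hu i

lemma contDiff_deriv_component (hu : ContDiff ℝ ∞ u) (i : Fin 3) :
    ContDiff ℝ ∞ fun y => deriv u y i :=
  contDiff_component (contDiff_infty_iff_deriv.1 hu).2 i

lemma hasDerivAt_component (hu : ContDiff ℝ ∞ u) (i : Fin 3) (x : ℝ) :
    HasDerivAt (fun y => u y i) (deriv u x i) x :=
  hasDerivAt_pi.1 ((contDiff_infty_iff_deriv.1 hu).1 x).hasDerivAt i

lemma hasDerivAt_b (hu : ContDiff ℝ ∞ u) (x : ℝ) :
    HasDerivAt (fun y => b (u y)) (b (deriv u x)) x := by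
  have hcomp := fun i => hasDerivAt_component hu i x
  exact (((hcomp 2).const_mul 2).add (hcomp 1)).sub (hcomp 0)

lemma hasDerivAt_param (hI : ∀ i, IsOpen (I i)) (hF : IsParam I F) (hu : ContDiff ℝ ∞ u)
    {x : ℝ} (hx : u x ∈ dom I) (i : Fin 3) :
    HasDerivAt (fun y => F i (u y i)) (deriv (F i) (u x i) * deriv u x i) x :=
  (hF.hasDerivAt hI (hx.1 i)).comp x (hasDerivAt_component hu i x)

lemma contDiffAt_param (hI : ∀ i, IsOpen (I i)) (hF : IsParam I F) (hu : ContDiff ℝ ∞ u)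
    {x : ℝ} (hx : u x ∈ dom I) (i : Fin 3) : ContDiffAt ℝ ∞ (fun y => F i (u y i)) x :=
  ContDiffAt.comp x (hF.contDiffAt hI (hx.1 i)) (contDiff_component hu i).contDiffAt

lemma contDiffAt_deriv_param (hI : ∀ i, IsOpen (I i)) (hF : IsParam I F) (hu : ContDiff ℝ ∞ u)
    {x : ℝ} (hx : u x ∈ dom I) (i : Fin 3) : ContDiffAt ℝ ∞ (fun y => deriv (F i) (u y i)) x :=
  ContDiffAt.comp x (hF.contDiffAt_deriv hI (hx.1 i)) (contDiff_component hu i).contDiffAt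

lemma contDiffAt_paramSum (hI : ∀ i, IsOpen (I i)) (hF : IsParam I F) (hu : ContDiff ℝ ∞ u)
    {x : ℝ} (hx : u x ∈ dom I) : ContDiffAt ℝ ∞ (fun y => paramSum F (u y)) x :=
  contDiffAt_const.mul (ContDiffAt.sum fun i _ =>
    contDiffAt_const.mul (contDiffAt_param hI hF hu hx i))

lemma hasDerivAt_paramSum (hI : ∀ i, IsOpen (I i)) (hF : IsParam I F) (hu : ContDiff ℝ ∞ u)
    {x : ℝ} (hx : u x ∈ dom I) : HasDerivAt (fun y => paramSum F (u y))
      ((1 / 2) * ∑ i, bCoeff i ^ 2 * (deriv (F i) (u x i) * deriv u x i)) x :=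
  (HasDerivAt.fun_sum fun i _ => (hasDerivAt_param hI hF hu hx i).const_mul _).const_mul _

lemma contDiffAt_tailSpeed (hI : ∀ i, IsOpen (I i)) (hF : IsParam I F) (hu : ContDiff ℝ ∞ u)
    {x : ℝ} (hx : u x ∈ dom I) (i : Fin 3) : ContDiffAt ℝ ∞ (fun y => tailSpeed F (u y) i) x := by
  simp only [tailSpeed_eq]
  exact ((((contDiff_b.comp hu).contDiffAt.div_const 2).mul contDiffAt_const).mul
    (contDiffAt_deriv_param hI hF hu hx i)).sub (contDiffAt_paramSum hI hF hu hx)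

lemma tsupport_sum_mul_subset (c : Fin 3 → ℝ → ℝ) (ξ : ℝ → Pt) :
    tsupport (fun y => ∑ j, c j y * ξ y j) ⊆ tsupport ξ :=
  closure_mono fun y hy hξy => hy (by simp [hξy])

lemma hasCompactSupport_sum_mul (hξ : IsTest ξ) (c : Fin 3 → ℝ → ℝ) :
    HasCompactSupport (fun y => ∑ j, c j y * ξ y j) :=
  hξ.2.mono' ((subset_tsupport _).trans (tsupport_sum_mul_subset c ξ))

lemma contDiff_sum_mul (hξ : IsTest ξ) {c : Fin 3 → ℝ → ℝ}
    (hc : ∀ x ∈ tsupport ξ, ∀ j, ContDiffAt ℝ ∞ (c j) x) :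
    ContDiff ℝ ∞ (fun y => ∑ j, c j y * ξ y j) :=
  contDiff_of_forall_tsupport fun x hx => ContDiffAt.sum fun j _ =>
    (hc x (tsupport_sum_mul_subset c ξ hx) j).mul (contDiff_component hξ.1 j).contDiffAt

lemma integrable_sum_mul (hξ : IsTest ξ) {c : Fin 3 → ℝ → ℝ}
    (hc : ∀ x ∈ tsupport ξ, ∀ j, ContDiffAt ℝ ∞ (c j) x) :
    Integrable (fun y => ∑ j, c j y * ξ y j) :=
  (contDiff_sum_mul hξ hc).continuous.integrable_of_hasCompactSupport
    (hasCompactSupport_sum_mul hξ c)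

lemma contDiff_Dinv_sum_mul (hξ : IsTest ξ) {c : Fin 3 → ℝ → ℝ}
    (hc : ∀ x ∈ tsupport ξ, ∀ j, ContDiffAt ℝ ∞ (c j) x) :
    ContDiff ℝ ∞ (Dinv fun y => ∑ j, c j y * ξ y j) :=
  contDiff_Dinv (contDiff_sum_mul hξ hc) (integrable_sum_mul hξ hc)

lemma hasDerivAt_Dinv_sum_mul (hξ : IsTest ξ) {c : Fin 3 → ℝ → ℝ}
    (hc : ∀ x ∈ tsupport ξ, ∀ j, ContDiffAt ℝ ∞ (c j) x) (x : ℝ) :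
    HasDerivAt (Dinv fun y => ∑ j, c j y * ξ y j) (∑ j, c j x * ξ x j) x :=
  hasDerivAt_Dinv (contDiff_sum_mul hξ hc).continuous (integrable_sum_mul hξ hc) x

lemma integrable_deriv_mul (hu : ContDiff ℝ ∞ u) (hξ : IsTest ξ) :
    Integrable fun y => ∑ j, deriv u y j * ξ y j :=
  integrable_sum_mul hξ fun _ _ j => (contDiff_deriv_component hu j).contDiffAt

lemma contDiff_momentum (hu : ContDiff ℝ ∞ u) (hξ : IsTest ξ) : ContDiff ℝ ∞ (momentum u ξ) :=
  contDiff_Dinv_sum_mul hξ fun _ _ j => (contDiff_deriv_component hu j).contDiffAt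

lemma hasDerivAt_momentum (hu : ContDiff ℝ ∞ u) (hξ : IsTest ξ) (x : ℝ) :
    HasDerivAt (momentum u ξ) (∑ j, deriv u x j * ξ x j) x :=
  hasDerivAt_Dinv_sum_mul hξ (fun _ _ j => (contDiff_deriv_component hu j).contDiffAt) x

lemma contDiffAt_tailSpeed_mul_deriv (hI : ∀ i, IsOpen (I i)) (hF : IsParam I F)
    (hu : ContDiff ℝ ∞ u) {x : ℝ} (hx : u x ∈ dom I) (j : Fin 3) :
    ContDiffAt ℝ ∞ (fun y => tailSpeed F (u y) j * deriv u y j) x :=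
  (contDiffAt_tailSpeed hI hF hu hx j).mul (contDiff_deriv_component hu j).contDiffAt

lemma contDiff_weightedMomentum (hI : ∀ i, IsOpen (I i)) (hF : IsParam I F)
    (hu : ContDiff ℝ ∞ u) (hξ : IsTest ξ) (hD : ∀ y ∈ tsupport ξ, u y ∈ dom I) :
    ContDiff ℝ ∞ (weightedMomentum F u ξ) :=
  contDiff_Dinv_sum_mul hξ fun x hx => contDiffAt_tailSpeed_mul_deriv hI hF hu (hD x hx)

lemma hasDerivAt_weightedMomentum (hI : ∀ i, IsOpen (I i)) (hF : IsParam I F)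
    (hu : ContDiff ℝ ∞ u) (hξ : IsTest ξ) (hD : ∀ y ∈ tsupport ξ, u y ∈ dom I) (x : ℝ) :
    HasDerivAt (weightedMomentum F u ξ) (∑ j, tailSpeed F (u x) j * deriv u x j * ξ x j) x :=
  hasDerivAt_Dinv_sum_mul hξ
    (fun x hx => contDiffAt_tailSpeed_mul_deriv hI hF hu (hD x hx)) x

lemma contDiff_hat (hu : ContDiff ℝ ∞ u) (hξ : IsTest ξ) (i : Fin 3) :
    ContDiff ℝ ∞ (hat u ξ i) :=
  ((contDiff_b.comp hu).mul (contDiff_component hξ.1 i)).add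
    (contDiff_const.mul (contDiff_momentum hu hξ))

lemma hasDerivAt_hat (hu : ContDiff ℝ ∞ u) (hξ : IsTest ξ) (i : Fin 3) (x : ℝ) :
    HasDerivAt (hat u ξ i) (hatDeriv u ξ i x) x :=
  ((hasDerivAt_b hu x).mul (hasDerivAt_component hξ.1 i x)).add
    ((hasDerivAt_momentum hu hξ x).const_mul _)

lemma contDiff_hatDeriv (hu : ContDiff ℝ ∞ u) (hξ : IsTest ξ) (i : Fin 3) :
    ContDiff ℝ ∞ (hatDeriv u ξ i) := by
  rw [← funext fun x => (hasDerivAt_hat hu hξ i x).deriv]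
  exact (contDiff_infty_iff_deriv.1 (contDiff_hat hu hξ i)).2

lemma contDiffAt_scalarPart (hI : ∀ i, IsOpen (I i)) (hF : IsParam I F) (hu : ContDiff ℝ ∞ u)
    (hξ : IsTest ξ) {x : ℝ} (hx : u x ∈ dom I) (i : Fin 3) :
    ContDiffAt ℝ ∞ (scalarPart F u ξ i) x :=
  ((contDiffAt_param hI hF hu hx i).mul (contDiff_hatDeriv hu hξ i).contDiffAt).add
    ((contDiffAt_const.mul ((contDiffAt_deriv_param hI hF hu hx i).mul
      (contDiff_deriv_component hu i).contDiffAt)).mul (contDiff_hat hu hξ i).contDiffAt)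

lemma contDiffAt_translationCoeff (hI : ∀ i, IsOpen (I i)) (hF : IsParam I F)
    (hu : ContDiff ℝ ∞ u) (hξ : IsTest ξ) (hD : ∀ y ∈ tsupport ξ, u y ∈ dom I) {x : ℝ}
    (hx : u x ∈ dom I) : ContDiffAt ℝ ∞ (translationCoeff F u ξ) x :=
  ((contDiff_weightedMomentum hI hF hu hξ hD).contDiffAt.add
    ((contDiffAt_paramSum hI hF hu hx).mul (contDiff_momentum hu hξ).contDiffAt)).sub
    (ContDiffAt.sum fun i _ => (contDiffAt_const.mul (contDiffAt_param hI hF hu hx i)).mul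
      (contDiff_hat hu hξ i).contDiffAt)

lemma contDiffAt_toOp_gasOp (hI : ∀ i, IsOpen (I i)) (hF : IsParam I F) (hu : ContDiff ℝ ∞ u)
    (hξ : IsTest ξ) (hD : ∀ y ∈ tsupport ξ, u y ∈ dom I) {x : ℝ} (hx : u x ∈ dom I) :
    ContDiffAt ℝ ∞ ((gasOp F).toOp u ξ) x := by
  rw [contDiffAt_pi]
  intro i
  simp only [toOp_gasOp]
  exact ((contDiff_b.comp hu).contDiffAt.mul (contDiffAt_scalarPart hI hF hu hξ hx i)).add
    ((contDiff_deriv_component hu i).contDiffAt.mul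
      (contDiffAt_translationCoeff hI hF hu hξ hD hx))

lemma hasDerivAt_translationCoeff (hI : ∀ i, IsOpen (I i)) (hF : IsParam I F)
    (hu : ContDiff ℝ ∞ u) (hξ : IsTest ξ) (hD : ∀ y ∈ tsupport ξ, u y ∈ dom I) {x : ℝ}
    (hx : u x ∈ dom I) :
    HasDerivAt (translationCoeff F u ξ) (-∑ j, bCoeff j * scalarPart F u ξ j x) x := by
  refine (((hasDerivAt_weightedMomentum hI hF hu hξ hD x).add
    ((hasDerivAt_paramSum hI hF hu hx).mul (hasDerivAt_momentum hu hξ x))).sub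
    (HasDerivAt.fun_sum (u := Finset.univ) fun i _ =>
      ((hasDerivAt_param hI hF hu hx i).const_mul (bCoeff i)).mul
        (hasDerivAt_hat hu hξ i x))).congr_deriv ?_
  simp only [tailSpeed_eq, scalarPart, hat, Fin.sum_univ_three, paramSum]
  ring

end Smoothness

section Endpoints

variable {F : Fin 3 → ℝ → ℝ} {u ξ : ℝ → Pt} {R x : ℝ}

lemma eq_zero_of_notMem_Ioo (hξR : tsupport ξ ⊆ Set.Ioo (-R) R) (hx : x ∉ Set.Ioo (-R) R) :
    ξ x = 0 :=
  image_eq_zero_of_notMem_tsupport fun h => hx (hξR h)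

lemma Dinv_sum_mul_neg_eq_neg (hξR : tsupport ξ ⊆ Set.Ioo (-R) R) (c : Fin 3 → ℝ → ℝ) :
    Dinv (fun y => ∑ j, c j y * ξ y j) (-R) = -Dinv (fun y => ∑ j, c j y * ξ y j) R :=
  Dinv_neg_eq_neg fun x hx => by simp [eq_zero_of_notMem_Ioo hξR hx]

lemma momentum_neg_eq_neg (u : ℝ → Pt) (hξR : tsupport ξ ⊆ Set.Ioo (-R) R) :
    momentum u ξ (-R) = -momentum u ξ R :=
  Dinv_sum_mul_neg_eq_neg hξR _

lemma weightedMomentum_neg_eq_neg (F : Fin 3 → ℝ → ℝ) (u : ℝ → Pt)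
    (hξR : tsupport ξ ⊆ Set.Ioo (-R) R) :
    weightedMomentum F u ξ (-R) = -weightedMomentum F u ξ R :=
  Dinv_sum_mul_neg_eq_neg hξR _

lemma hat_of_eq_zero (u : ℝ → Pt) (hx : ξ x = 0) (i : Fin 3) :
    hat u ξ i x = bCoeff i * momentum u ξ x := by
  simp [hat, hx]

lemma translationCoeff_of_eq_zero (F : Fin 3 → ℝ → ℝ) (u : ℝ → Pt) (hx : ξ x = 0) :
    translationCoeff F u ξ x = weightedMomentum F u ξ x - paramSum F (u x) * momentum u ξ x := by
  simp only [translationCoeff, hat_of_eq_zero u hx, paramSum, Fin.sum_univ_three]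
  ring

end Endpoints

/-! ### The bracket -/

section Bracket

variable {I : Fin 3 → Set ℝ} {F : Fin 3 → ℝ → ℝ} {u v w ξ η : ℝ → Pt} {R x : ℝ}

lemma integral_eq_integral_of_hasDerivAt_sub {E : Type*} [NormedAddCommGroup E] [NormedSpace ℝ E]
    [CompleteSpace E] {f g Q : ℝ → E} {a c : ℝ} (hf : IntervalIntegrable f volume a c)
    (hg : IntervalIntegrable g volume a c)
    (hQ : ∀ x ∈ Set.uIcc a c, HasDerivAt Q (f x - g x) x) (hend : Q c = Q a) :
    ∫ x in a..c, f x = ∫ x in a..c, g x := by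
  have hsub := intervalIntegral.integral_eq_sub_of_hasDerivAt hQ (hf.sub hg)
  rw [intervalIntegral.integral_sub hf hg, hend, sub_self] at hsub
  exact sub_eq_zero.1 hsub

lemma intervalIntegrable_of_contDiffAt {E : Type*} [NormedAddCommGroup E] [NormedSpace ℝ E]
    {n : WithTop ℕ∞} {g : ℝ → E} {a c : ℝ} (hg : ∀ x ∈ Set.uIcc a c, ContDiffAt ℝ n g x) :
    IntervalIntegrable g volume a c :=
  ContinuousOn.intervalIntegrable fun x hx => (hg x hx).continuousAt.continuousWithinAt

lemma forall_tsupport_mem_dom (hξR : tsupport ξ ⊆ Set.Ioo (-R) R)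
    (hD : ∀ x ∈ Set.uIcc (-R) R, u x ∈ dom I) : ∀ y ∈ tsupport ξ, u y ∈ dom I :=
  fun y hy => hD y (Set.Icc_subset_uIcc (Set.Ioo_subset_Icc_self (hξR hy)))

/-- Half the Wronskian of the transformed covectors `hat v ξ i` and `hat w η i`. The bracket uses
it with `v = w = u`; two independent fields make it bilinear, hence easy to vary. -/
noncomputable def halfWronskian (v w ξ η : ℝ → Pt) (i : Fin 3) (x : ℝ) : ℝ :=
  (1 / 2) * (hat v ξ i x * hatDeriv w η i x - hatDeriv v ξ i x * hat w η i x)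

/-- The density `∑ F_i(u^i) halfWronskian v u ξ η i`. For `v = u` it is the density of the bracket;
for `v = X` it describes the variation of `ξ̂` along `X`. -/
noncomputable def bracketDensity (F : Fin 3 → ℝ → ℝ) (u v ξ η : ℝ → Pt) (x : ℝ) : ℝ :=
  ∑ i, F i (u x i) * halfWronskian v u ξ η i x

/-- The product `½ ∑ F_i(u^i) ξ̂_i η̂_i` whose derivative relates `scalarPart` to the bracket
density; the first covector is transformed with the field `v`, the second one with `u`. -/
noncomputable def hatProduct (F : Fin 3 → ℝ → ℝ) (u v ξ η : ℝ → Pt) (x : ℝ) : ℝ :=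
  (1 / 2) * ∑ i, F i (u x i) * (hat v ξ i x * hat u η i x)

lemma halfWronskian_swap (v w ξ η : ℝ → Pt) (i : Fin 3) (x : ℝ) :
    halfWronskian v w ξ η i x = -halfWronskian w v η ξ i x := by
  unfold halfWronskian
  ring

lemma bracketDensity_swap (F : Fin 3 → ℝ → ℝ) (u ξ η : ℝ → Pt) (x : ℝ) :
    bracketDensity F u u ξ η x = -bracketDensity F u u η ξ x := by
  simp only [bracketDensity, halfWronskian_swap u u ξ η, mul_neg, Finset.sum_neg_distrib]

lemma contDiff_halfWronskian (hv : ContDiff ℝ ∞ v) (hw : ContDiff ℝ ∞ w) (hξ : IsTest ξ)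
    (hη : IsTest η) (i : Fin 3) : ContDiff ℝ ∞ (halfWronskian v w ξ η i) :=
  contDiff_const.mul (((contDiff_hat hv hξ i).mul (contDiff_hatDeriv hw hη i)).sub
    ((contDiff_hatDeriv hv hξ i).mul (contDiff_hat hw hη i)))

lemma contDiffAt_bracketDensity (hI : ∀ i, IsOpen (I i)) (hF : IsParam I F) (hu : ContDiff ℝ ∞ u)
    (hv : ContDiff ℝ ∞ v) (hξ : IsTest ξ) (hη : IsTest η) (hx : u x ∈ dom I) :
    ContDiffAt ℝ ∞ (bracketDensity F u v ξ η) x :=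
  ContDiffAt.sum fun i _ => (contDiffAt_param hI hF hu hx i).mul
    (contDiff_halfWronskian hv hu hξ hη i).contDiffAt

lemma hasDerivAt_hatProduct (hI : ∀ i, IsOpen (I i)) (hF : IsParam I F) (hu : ContDiff ℝ ∞ u)
    (hv : ContDiff ℝ ∞ v) (hξ : IsTest ξ) (hη : IsTest η) (hx : u x ∈ dom I) :
    HasDerivAt (hatProduct F u v ξ η)
      (∑ i, hat v ξ i x * scalarPart F u η i x - bracketDensity F u v ξ η x) x := by
  refine ((HasDerivAt.fun_sum (u := Finset.univ) fun i _ =>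
    (hasDerivAt_param hI hF hu hx i).mul
      ((hasDerivAt_hat hv hξ i x).mul (hasDerivAt_hat hu hη i x))).const_mul (1 / 2)).congr_deriv ?_
  rw [bracketDensity, ← Finset.sum_sub_distrib, Finset.mul_sum]
  refine Finset.sum_congr rfl fun i _ => ?_
  simp only [halfWronskian, scalarPart, Pi.mul_apply]
  ring

lemma hatProduct_of_eq_zero (F : Fin 3 → ℝ → ℝ) (u v : ℝ → Pt) (hξ : ξ x = 0) (hη : η x = 0) :
    hatProduct F u v ξ η x = paramSum F (u x) * momentum v ξ x * momentum u η x := by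
  simp only [hatProduct, hat_of_eq_zero _ hξ, hat_of_eq_zero _ hη, paramSum, Fin.sum_univ_three]
  ring

lemma pairing_eq_intervalIntegral (T : Op) (u η : ℝ → Pt) (hξR : tsupport ξ ⊆ Set.Ioo (-R) R) :
    pairing T u ξ η = ∫ x in -R..R, ∑ i, ξ x i * T u η x i := by
  refine (intervalIntegral.integral_eq_integral_of_support_subset fun x hx => ?_).symm
  by_contra hxR
  have hξx : ξ x = 0 := eq_zero_of_notMem_Ioo hξR fun h => hxR (Set.Ioo_subset_Ioc_self h)
  exact hx (by simp [hξx])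

lemma pairing_gasOp (hI : ∀ i, IsOpen (I i)) (hF : IsParam I F) (hu : ContDiff ℝ ∞ u)
    (hξ : IsTest ξ) (hη : IsTest η) (hξR : tsupport ξ ⊆ Set.Ioo (-R) R)
    (hηR : tsupport η ⊆ Set.Ioo (-R) R) (hD : ∀ x ∈ Set.uIcc (-R) R, u x ∈ dom I) :
    pairing (gasOp F).toOp u ξ η = ∫ x in -R..R, bracketDensity F u u ξ η x := by
  have hDη := forall_tsupport_mem_dom hηR hD
  rw [pairing_eq_intervalIntegral _ _ _ hξR]
  refine integral_eq_integral_of_hasDerivAt_sub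
    (Q := fun x => momentum u ξ x * translationCoeff F u η x + hatProduct F u u ξ η x)
    (intervalIntegrable_of_contDiffAt fun x hx => ContDiffAt.sum fun i _ =>
      (contDiff_component hξ.1 i).contDiffAt.mul
        (contDiffAt_pi.1 (contDiffAt_toOp_gasOp hI hF hu hη hDη (hD x hx)) i))
    (intervalIntegrable_of_contDiffAt fun x hx =>
      contDiffAt_bracketDensity hI hF hu hu hξ hη (hD x hx)) (fun x hx => ?_) ?_
  · refine (((hasDerivAt_momentum hu hξ x).mul
      (hasDerivAt_translationCoeff hI hF hu hη hDη (hD x hx))).add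
      (hasDerivAt_hatProduct hI hF hu hu hξ hη (hD x hx))).congr_deriv ?_
    simp only [toOp_gasOp, hat, Fin.sum_univ_three]
    ring
  · have boundary : ∀ y ∉ Set.Ioo (-R) R, momentum u ξ y * translationCoeff F u η y
        + hatProduct F u u ξ η y = momentum u ξ y * weightedMomentum F u η y := fun y hy => by
      rw [translationCoeff_of_eq_zero F u (eq_zero_of_notMem_Ioo hηR hy),
        hatProduct_of_eq_zero F u u (eq_zero_of_notMem_Ioo hξR hy) (eq_zero_of_notMem_Ioo hηR hy)]
      ring
    rw [boundary R (by simp), boundary (-R) (by simp), momentum_neg_eq_neg u hξR,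
      weightedMomentum_neg_eq_neg F u hηR, neg_mul_neg]

end Bracket

/-! ### The derivative of the bracket along a variation of the field -/

section Variation

variable {I : Fin 3 → Set ℝ} {F : Fin 3 → ℝ → ℝ} {u ξ η X : ℝ → Pt} {R x : ℝ}

lemma hasDerivAt_intervalIntegral_of_continuousOn {E : Type*} [NormedAddCommGroup E]
    [NormedSpace ℝ E] {G G' : ℝ → ℝ → E} {a c ε₀ δ : ℝ} (hδ : 0 < δ)
    (hG : ContinuousOn (fun z : ℝ × ℝ => G z.1 z.2) (Metric.closedBall ε₀ δ ×ˢ Set.uIcc a c))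
    (hG' : ContinuousOn (fun z : ℝ × ℝ => G' z.1 z.2) (Metric.closedBall ε₀ δ ×ˢ Set.uIcc a c))
    (hderiv : ∀ ε ∈ Metric.closedBall ε₀ δ, ∀ x ∈ Set.uIcc a c,
      HasDerivAt (fun ε => G ε x) (G' ε x) ε) :
    HasDerivAt (fun ε => ∫ x in a..c, G ε x) (∫ x in a..c, G' ε₀ x) ε₀ := by
  obtain ⟨C, hC⟩ := ((isCompact_closedBall ε₀ δ).prod
    (isCompact_uIcc (a := a) (b := c))).exists_bound_of_continuousOn hG'
  have slice_integrable : ∀ {g : ℝ → ℝ → E}, ContinuousOn (fun z : ℝ × ℝ => g z.1 z.2)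
      (Metric.closedBall ε₀ δ ×ˢ Set.uIcc a c) → ∀ ε ∈ Metric.closedBall ε₀ δ,
      IntervalIntegrable (g ε) volume a c := fun {g} hg ε hε =>
    (hg.comp (f := fun x => (ε, x)) (by fun_prop) fun x hx => ⟨hε, hx⟩).intervalIntegrable
  have center_mem : ε₀ ∈ Metric.closedBall ε₀ δ := Metric.mem_closedBall_self hδ.le
  have ball_mem : Metric.closedBall ε₀ δ ∈ 𝓝 ε₀ := Metric.closedBall_mem_nhds ε₀ hδ
  exact (intervalIntegral.hasDerivAt_integral_of_dominated_loc_of_deriv_le (bound := fun _ => C)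
    ball_mem
    (eventually_of_mem ball_mem fun ε hε => (slice_integrable hG ε hε).def'.aestronglyMeasurable)
    (slice_integrable hG ε₀ center_mem)
    (slice_integrable hG' ε₀ center_mem).def'.aestronglyMeasurable
    (Eventually.of_forall fun x hx ε hε => hC (ε, x) ⟨hε, Set.uIoc_subset_uIcc hx⟩)
    intervalIntegrable_const
    (Eventually.of_forall fun x hx ε hε => hderiv ε hε x (Set.uIoc_subset_uIcc hx))).2

lemma eventually_forall_add_smul_mem {E : Type*} [NormedAddCommGroup E] [NormedSpace ℝ E]
    {s : Set E} {K : Set ℝ} (hs : IsOpen s) (hK : IsCompact K) {U V : ℝ → E} (hU : Continuous U)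
    (hV : Continuous V) (h : ∀ x ∈ K, U x ∈ s) :
    ∀ᶠ ε in 𝓝 (0 : ℝ), ∀ x ∈ K, U x + ε • V x ∈ s := by
  refine hK.eventually_forall_of_forall_eventually fun x hx => ?_
  have hcont : Continuous fun z : ℝ × ℝ => U z.2 + z.1 • V z.2 := by fun_prop
  exact hcont.continuousAt.eventually_mem (hs.mem_nhds (by simpa using h x hx))

lemma b_add_smul (p q : Pt) (ε : ℝ) : b (p + ε • q) = b p + ε * b q := by
  simp only [b, Pi.add_apply, Pi.smul_apply, smul_eq_mul]
  ring

lemma deriv_add_smul (hu : ContDiff ℝ ∞ u) (hX : ContDiff ℝ ∞ X) (ε x : ℝ) :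
    deriv (fun y => u y + ε • X y) x = deriv u x + ε • deriv X x :=
  (((contDiff_infty_iff_deriv.1 hu).1 x).hasDerivAt.add
    (((contDiff_infty_iff_deriv.1 hX).1 x).hasDerivAt.const_smul ε)).deriv

lemma momentum_add_smul (hu : ContDiff ℝ ∞ u) (hX : ContDiff ℝ ∞ X) (hξ : IsTest ξ) (ε x : ℝ) :
    momentum (fun y => u y + ε • X y) ξ x = momentum u ξ x + ε * momentum X ξ x := by
  unfold momentum
  rw [← Dinv_const_mul, ← Dinv_add (integrable_deriv_mul hu hξ)
    ((integrable_deriv_mul hX hξ).const_mul ε)]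
  congr 1
  funext y
  simp only [deriv_add_smul hu hX, Fin.sum_univ_three, Pi.add_apply, Pi.smul_apply, smul_eq_mul]
  ring

lemma hat_add_smul (hu : ContDiff ℝ ∞ u) (hX : ContDiff ℝ ∞ X) (hξ : IsTest ξ) (ε : ℝ)
    (i : Fin 3) (x : ℝ) :
    hat (fun y => u y + ε • X y) ξ i x = hat u ξ i x + ε * hat X ξ i x := by
  simp only [hat, momentum_add_smul hu hX hξ, b_add_smul]
  ring

lemma hatDeriv_add_smul (hu : ContDiff ℝ ∞ u) (hX : ContDiff ℝ ∞ X) (ξ : ℝ → Pt) (ε : ℝ)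
    (i : Fin 3) (x : ℝ) :
    hatDeriv (fun y => u y + ε • X y) ξ i x = hatDeriv u ξ i x + ε * hatDeriv X ξ i x := by
  simp only [hatDeriv, deriv_add_smul hu hX, b_add_smul, Fin.sum_univ_three, Pi.add_apply,
    Pi.smul_apply, smul_eq_mul]
  ring

/-- The contribution of the coefficients `F_i(u^i)` to the derivative of the bracket density in the
direction `X` of the field `u`. -/
noncomputable def paramVariation (F : Fin 3 → ℝ → ℝ) (u X ξ η : ℝ → Pt) (x : ℝ) : ℝ :=
  ∑ i, deriv (F i) (u x i) * X x i * halfWronskian u u ξ η i x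

/-- The derivative of `bracketDensity F u u ξ η` in the direction `X` of the field `u`. -/
noncomputable def bracketVariation (F : Fin 3 → ℝ → ℝ) (u X ξ η : ℝ → Pt) (x : ℝ) : ℝ :=
  paramVariation F u X ξ η x + bracketDensity F u X ξ η x - bracketDensity F u X η ξ x

lemma hasDerivAt_bracketDensity (hI : ∀ i, IsOpen (I i)) (hF : IsParam I F)
    (hu : ContDiff ℝ ∞ u) (hX : ContDiff ℝ ∞ X) (hξ : IsTest ξ) (hη : IsTest η) {ε : ℝ}
    (hx : u x + ε • X x ∈ dom I) :
    HasDerivAt (fun ε : ℝ => bracketDensity F (fun y => u y + ε • X y)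
        (fun y => u y + ε • X y) ξ η x)
      (bracketVariation F (fun y => u y + ε • X y) X ξ η x) ε := by
  have affine : ∀ p q : ℝ, HasDerivAt (fun ε : ℝ => p + ε * q) q ε := fun p q => by
    simpa using ((hasDerivAt_id ε).mul_const q).const_add p
  have hparam : ∀ i, HasDerivAt (fun ε : ℝ => F i (u x i + ε * X x i))
      (deriv (F i) (u x i + ε * X x i) * X x i) ε := fun i =>
    (hF.hasDerivAt hI (hx.1 i)).comp ε (affine (u x i) (X x i))
  have hhat : ∀ {θ : ℝ → Pt}, IsTest θ → ∀ i,
      HasDerivAt (fun ε : ℝ => hat (fun y => u y + ε • X y) θ i x) (hat X θ i x) ε :=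
    fun hθ i => by simpa only [hat_add_smul hu hX hθ] using affine _ _
  have hhatDeriv : ∀ (θ : ℝ → Pt) i,
      HasDerivAt (fun ε : ℝ => hatDeriv (fun y => u y + ε • X y) θ i x) (hatDeriv X θ i x) ε :=
    fun θ i => by simpa only [hatDeriv_add_smul hu hX] using affine _ _
  refine (HasDerivAt.fun_sum fun i _ => (hparam i).mul ((((hhat hξ i).mul (hhatDeriv η i)).sub
    ((hhatDeriv ξ i).mul (hhat hη i))).const_mul (1 / 2))).congr_deriv ?_
  rw [bracketVariation, paramVariation, bracketDensity, bracketDensity, ← Finset.sum_add_distrib,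
    ← Finset.sum_sub_distrib]
  refine Finset.sum_congr rfl fun i _ => ?_
  simp only [halfWronskian, Pi.add_apply, Pi.smul_apply, Pi.mul_apply, Pi.sub_apply, smul_eq_mul]
  ring

lemma continuous_hat_add_smul (hu : ContDiff ℝ ∞ u) (hX : ContDiff ℝ ∞ X) (hξ : IsTest ξ)
    (i : Fin 3) : Continuous fun z : ℝ × ℝ => hat (fun y => u y + z.1 • X y) ξ i z.2 := by
  simp only [hat_add_smul hu hX hξ]
  exact ((contDiff_hat hu hξ i).continuous.comp continuous_snd).add
    (continuous_fst.mul ((contDiff_hat hX hξ i).continuous.comp continuous_snd))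

lemma continuous_hatDeriv_add_smul (hu : ContDiff ℝ ∞ u) (hX : ContDiff ℝ ∞ X) (hξ : IsTest ξ)
    (i : Fin 3) : Continuous fun z : ℝ × ℝ => hatDeriv (fun y => u y + z.1 • X y) ξ i z.2 := by
  simp only [hatDeriv_add_smul hu hX]
  exact ((contDiff_hatDeriv hu hξ i).continuous.comp continuous_snd).add
    (continuous_fst.mul ((contDiff_hatDeriv hX hξ i).continuous.comp continuous_snd))

section JointContinuity

variable {K : Set (ℝ × ℝ)}

lemma continuousOn_param_add_smul {g : ℝ → ℝ} {i : Fin 3} (hg : ContinuousOn g (I i))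
    (hu : ContDiff ℝ ∞ u) (hX : ContDiff ℝ ∞ X) (hK : ∀ z ∈ K, u z.2 + z.1 • X z.2 ∈ dom I) :
    ContinuousOn (fun z : ℝ × ℝ => g ((u z.2 + z.1 • X z.2) i)) K := by
  have inner_continuous : Continuous fun z : ℝ × ℝ => u z.2 + z.1 • X z.2 :=
    (hu.continuous.comp continuous_snd).add
      (continuous_fst.smul (hX.continuous.comp continuous_snd))
  exact hg.comp ((continuous_apply i).comp inner_continuous).continuousOn fun z hz => (hK z hz).1 i

lemma continuousOn_bracketDensity_add_smul_self (hF : IsParam I F) (hu : ContDiff ℝ ∞ u)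
    (hX : ContDiff ℝ ∞ X) (hξ : IsTest ξ) (hη : IsTest η)
    (hK : ∀ z ∈ K, u z.2 + z.1 • X z.2 ∈ dom I) :
    ContinuousOn (fun z : ℝ × ℝ => bracketDensity F (fun y => u y + z.1 • X y)
      (fun y => u y + z.1 • X y) ξ η z.2) K :=
  continuousOn_finsetSum _ fun i _ =>
    (continuousOn_param_add_smul (hF i).continuousOn hu hX hK).mul (continuous_const.mul
      (((continuous_hat_add_smul hu hX hξ i).mul (continuous_hatDeriv_add_smul hu hX hη i)).sub
        ((continuous_hatDeriv_add_smul hu hX hξ i).mul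
          (continuous_hat_add_smul hu hX hη i)))).continuousOn

lemma continuousOn_paramVariation_add_smul (hI : ∀ i, IsOpen (I i)) (hF : IsParam I F)
    (hu : ContDiff ℝ ∞ u) (hX : ContDiff ℝ ∞ X) (hξ : IsTest ξ) (hη : IsTest η)
    (hK : ∀ z ∈ K, u z.2 + z.1 • X z.2 ∈ dom I) :
    ContinuousOn (fun z : ℝ × ℝ => paramVariation F (fun y => u y + z.1 • X y) X ξ η z.2) K :=
  continuousOn_finsetSum _ fun i _ =>
    ((continuousOn_param_add_smul (fun _ hs =>
      (hF.contDiffAt_deriv hI hs).continuousAt.continuousWithinAt) hu hX hK).mul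
      ((contDiff_component hX i).continuous.comp continuous_snd).continuousOn).mul
    (continuous_const.mul
      (((continuous_hat_add_smul hu hX hξ i).mul (continuous_hatDeriv_add_smul hu hX hη i)).sub
        ((continuous_hatDeriv_add_smul hu hX hξ i).mul
          (continuous_hat_add_smul hu hX hη i)))).continuousOn

lemma continuousOn_bracketDensity_add_smul (hF : IsParam I F) (hu : ContDiff ℝ ∞ u)
    (hX : ContDiff ℝ ∞ X) (hξ : IsTest ξ) (hη : IsTest η)
    (hK : ∀ z ∈ K, u z.2 + z.1 • X z.2 ∈ dom I) :
    ContinuousOn (fun z : ℝ × ℝ => bracketDensity F (fun y => u y + z.1 • X y) X ξ η z.2) K :=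
  continuousOn_finsetSum _ fun i _ =>
    (continuousOn_param_add_smul (hF i).continuousOn hu hX hK).mul (continuous_const.mul
      ((((contDiff_hat hX hξ i).continuous.comp continuous_snd).mul
        (continuous_hatDeriv_add_smul hu hX hη i)).sub
      (((contDiff_hatDeriv hX hξ i).continuous.comp continuous_snd).mul
        (continuous_hat_add_smul hu hX hη i)))).continuousOn

lemma continuousOn_bracketVariation_add_smul (hI : ∀ i, IsOpen (I i)) (hF : IsParam I F)
    (hu : ContDiff ℝ ∞ u) (hX : ContDiff ℝ ∞ X) (hξ : IsTest ξ) (hη : IsTest η)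
    (hK : ∀ z ∈ K, u z.2 + z.1 • X z.2 ∈ dom I) :
    ContinuousOn (fun z : ℝ × ℝ => bracketVariation F (fun y => u y + z.1 • X y) X ξ η z.2) K :=
  ((continuousOn_paramVariation_add_smul hI hF hu hX hξ hη hK).add
    (continuousOn_bracketDensity_add_smul hF hu hX hξ hη hK)).sub
    (continuousOn_bracketDensity_add_smul hF hu hX hη hξ hK)

end JointContinuity

lemma hasDerivAt_pairing (hI : ∀ i, IsOpen (I i)) (hF : IsParam I F) (hu : ContDiff ℝ ∞ u)
    (hX : ContDiff ℝ ∞ X) (hξ : IsTest ξ) (hη : IsTest η) (hξR : tsupport ξ ⊆ Set.Ioo (-R) R)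
    (hηR : tsupport η ⊆ Set.Ioo (-R) R) (hD : ∀ x ∈ Set.uIcc (-R) R, u x ∈ dom I) :
    HasDerivAt (fun ε : ℝ => pairing (gasOp F).toOp (fun x => u x + ε • X x) ξ η)
      (∫ x in -R..R, bracketVariation F u X ξ η x) 0 := by
  have near_dom := eventually_forall_add_smul_mem (isOpen_dom hI) isCompact_uIcc hu.continuous
    hX.continuous hD
  obtain ⟨δ, hδ, hball⟩ := Metric.eventually_nhds_iff_ball.1 near_dom
  have mem_dom : ∀ z ∈ Metric.closedBall (0 : ℝ) (δ / 2) ×ˢ Set.uIcc (-R) R,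
      u z.2 + z.1 • X z.2 ∈ dom I := fun z hz =>
    hball z.1 (Metric.closedBall_subset_ball (half_lt_self hδ) hz.1) z.2 hz.2
  have key := hasDerivAt_intervalIntegral_of_continuousOn (half_pos hδ)
    (continuousOn_bracketDensity_add_smul_self hF hu hX hξ hη mem_dom)
    (continuousOn_bracketVariation_add_smul hI hF hu hX hξ hη mem_dom)
    fun ε hε x hx => hasDerivAt_bracketDensity hI hF hu hX hξ hη (mem_dom (ε, x) ⟨hε, hx⟩)
  simp only [zero_smul, add_zero] at key
  refine key.congr_of_eventuallyEq ?_
  filter_upwards [near_dom] with ε hε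
  exact pairing_gasOp hI hF (hu.add (hX.const_smul ε)) hξ hη hξR hηR hε

end Variation

/-! ### The Jacobi identity -/

section Jacobi

variable {I : Fin 3 → Set ℝ} {F : Fin 3 → ℝ → ℝ} {u ξ η X : ℝ → Pt} {R x : ℝ}

/-- The contribution of the variation of `ξ̂` along `X` to the derivative of the bracket density,
integrated by parts so that no nonlocal quantity of `X` is left. -/
noncomputable def hatVariation (F : Fin 3 → ℝ → ℝ) (u X ξ η : ℝ → Pt) (x : ℝ) : ℝ :=
  b (X x) * ∑ i, scalarPart F u η i x * ξ x i
    + (∑ i, bCoeff i * scalarPart F u η i x) * ∑ i, X x i * ξ x i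
    - translationCoeff F u η x * ∑ i, X x i * deriv ξ x i

/-- `bracketVariation F u X ξ η` up to a total derivative, without nonlocal quantities of `X`. -/
noncomputable def localVariation (F : Fin 3 → ℝ → ℝ) (u X ξ η : ℝ → Pt) (x : ℝ) : ℝ :=
  paramVariation F u X ξ η x + hatVariation F u X ξ η x - hatVariation F u X η ξ x

lemma contDiffAt_paramVariation (hI : ∀ i, IsOpen (I i)) (hF : IsParam I F)
    (hu : ContDiff ℝ ∞ u) (hX : ContDiff ℝ ∞ X) (hξ : IsTest ξ) (hη : IsTest η)
    (hx : u x ∈ dom I) : ContDiffAt ℝ ∞ (paramVariation F u X ξ η) x :=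
  ContDiffAt.sum fun i _ => ((contDiffAt_deriv_param hI hF hu hx i).mul
    (contDiff_component hX i).contDiffAt).mul (contDiff_halfWronskian hu hu hξ hη i).contDiffAt

lemma contDiffAt_hatVariation (hI : ∀ i, IsOpen (I i)) (hF : IsParam I F)
    (hu : ContDiff ℝ ∞ u) (hX : ContDiff ℝ ∞ X) (hξ : IsTest ξ) (hη : IsTest η)
    (hD : ∀ y ∈ tsupport η, u y ∈ dom I) (hx : u x ∈ dom I) :
    ContDiffAt ℝ ∞ (hatVariation F u X ξ η) x := by
  have hscalar := fun i => contDiffAt_scalarPart hI hF hu hη hx i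
  have hXi := fun i => (contDiff_component hX i).contDiffAt (x := x)
  have hξi := fun i => (contDiff_component hξ.1 i).contDiffAt (x := x)
  have hξi' := fun i => (contDiff_deriv_component hξ.1 i).contDiffAt (x := x)
  exact (((contDiff_b.comp hX).contDiffAt.mul
      (ContDiffAt.sum fun i _ => (hscalar i).mul (hξi i))).add
    ((ContDiffAt.sum fun i _ => contDiffAt_const.mul (hscalar i)).mul
      (ContDiffAt.sum fun i _ => (hXi i).mul (hξi i)))).sub
    ((contDiffAt_translationCoeff hI hF hu hη hD hx).mul
      (ContDiffAt.sum fun i _ => (hXi i).mul (hξi' i)))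

lemma hasDerivAt_sum_mul_sub_momentum (hX : ContDiff ℝ ∞ X) (hξ : IsTest ξ) (x : ℝ) :
    HasDerivAt (fun y => ∑ i, X y i * ξ y i - momentum X ξ y) (∑ i, X x i * deriv ξ x i) x := by
  refine ((HasDerivAt.fun_sum (u := Finset.univ) fun i _ => (hasDerivAt_component hX i x).mul
    (hasDerivAt_component hξ.1 i x)).sub (hasDerivAt_momentum hX hξ x)).congr_deriv ?_
  rw [Finset.sum_add_distrib]
  ring

lemma integral_bracketDensity_eq_hatVariation (hI : ∀ i, IsOpen (I i)) (hF : IsParam I F)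
    (hu : ContDiff ℝ ∞ u) (hX : ContDiff ℝ ∞ X) (hξ : IsTest ξ) (hη : IsTest η)
    (hξR : tsupport ξ ⊆ Set.Ioo (-R) R) (hηR : tsupport η ⊆ Set.Ioo (-R) R)
    (hD : ∀ x ∈ Set.uIcc (-R) R, u x ∈ dom I) :
    ∫ x in -R..R, bracketDensity F u X ξ η x = ∫ x in -R..R, hatVariation F u X ξ η x := by
  have hDη := forall_tsupport_mem_dom hηR hD
  refine integral_eq_integral_of_hasDerivAt_sub
    (Q := fun x => translationCoeff F u η x * (∑ i, X x i * ξ x i - momentum X ξ x)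
      - hatProduct F u X ξ η x)
    (intervalIntegrable_of_contDiffAt fun x hx =>
      contDiffAt_bracketDensity hI hF hu hX hξ hη (hD x hx))
    (intervalIntegrable_of_contDiffAt fun x hx =>
      contDiffAt_hatVariation hI hF hu hX hξ hη hDη (hD x hx)) (fun x hx => ?_) ?_
  · refine (((hasDerivAt_translationCoeff hI hF hu hη hDη (hD x hx)).mul
      (hasDerivAt_sum_mul_sub_momentum hX hξ x)).sub
      (hasDerivAt_hatProduct hI hF hu hX hξ hη (hD x hx))).congr_deriv ?_
    simp only [hatVariation, hat, Fin.sum_univ_three]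
    ring
  · have boundary : ∀ y ∉ Set.Ioo (-R) R,
        translationCoeff F u η y * (∑ i, X y i * ξ y i - momentum X ξ y) - hatProduct F u X ξ η y
          = -(weightedMomentum F u η y * momentum X ξ y) := fun y hy => by
      have hξy := eq_zero_of_notMem_Ioo hξR hy
      have hηy := eq_zero_of_notMem_Ioo hηR hy
      rw [translationCoeff_of_eq_zero F u hηy, hatProduct_of_eq_zero F u X hξy hηy]
      simp only [hξy, Pi.zero_apply, mul_zero, Finset.sum_const_zero]
      ring
    rw [boundary R (by simp), boundary (-R) (by simp), momentum_neg_eq_neg X hξR,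
      weightedMomentum_neg_eq_neg F u hηR, neg_mul_neg]

lemma intervalIntegrable_localVariation (hI : ∀ i, IsOpen (I i)) (hF : IsParam I F)
    (hu : ContDiff ℝ ∞ u) (hX : ContDiff ℝ ∞ X) (hξ : IsTest ξ) (hη : IsTest η)
    (hξR : tsupport ξ ⊆ Set.Ioo (-R) R) (hηR : tsupport η ⊆ Set.Ioo (-R) R)
    (hD : ∀ x ∈ Set.uIcc (-R) R, u x ∈ dom I) :
    IntervalIntegrable (localVariation F u X ξ η) volume (-R) R :=
  intervalIntegrable_of_contDiffAt fun x hx =>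
    ((contDiffAt_paramVariation hI hF hu hX hξ hη (hD x hx)).add
      (contDiffAt_hatVariation hI hF hu hX hξ hη (forall_tsupport_mem_dom hηR hD) (hD x hx))).sub
      (contDiffAt_hatVariation hI hF hu hX hη hξ (forall_tsupport_mem_dom hξR hD) (hD x hx))

lemma integral_bracketVariation (hI : ∀ i, IsOpen (I i)) (hF : IsParam I F)
    (hu : ContDiff ℝ ∞ u) (hX : ContDiff ℝ ∞ X) (hξ : IsTest ξ) (hη : IsTest η)
    (hξR : tsupport ξ ⊆ Set.Ioo (-R) R) (hηR : tsupport η ⊆ Set.Ioo (-R) R)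
    (hD : ∀ x ∈ Set.uIcc (-R) R, u x ∈ dom I) :
    ∫ x in -R..R, bracketVariation F u X ξ η x = ∫ x in -R..R, localVariation F u X ξ η x := by
  have param_integrable : IntervalIntegrable (paramVariation F u X ξ η) volume (-R) R :=
    intervalIntegrable_of_contDiffAt fun x hx =>
      contDiffAt_paramVariation hI hF hu hX hξ hη (hD x hx)
  have density_integrable : ∀ {θ θ' : ℝ → Pt}, IsTest θ → IsTest θ' →
      IntervalIntegrable (bracketDensity F u X θ θ') volume (-R) R := fun hθ hθ' =>
    intervalIntegrable_of_contDiffAt fun x hx =>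
      contDiffAt_bracketDensity hI hF hu hX hθ hθ' (hD x hx)
  have hat_integrable : ∀ {θ θ' : ℝ → Pt}, IsTest θ → IsTest θ' → tsupport θ' ⊆ Set.Ioo (-R) R →
      IntervalIntegrable (hatVariation F u X θ θ') volume (-R) R := fun hθ hθ' hθR =>
    intervalIntegrable_of_contDiffAt fun x hx =>
      contDiffAt_hatVariation hI hF hu hX hθ hθ' (forall_tsupport_mem_dom hθR hD) (hD x hx)
  unfold bracketVariation localVariation
  rw [intervalIntegral.integral_sub (param_integrable.add (density_integrable hξ hη))
      (density_integrable hη hξ),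
    intervalIntegral.integral_add param_integrable (density_integrable hξ hη),
    intervalIntegral.integral_sub (param_integrable.add (hat_integrable hξ hη hηR))
      (hat_integrable hη hξ hξR),
    intervalIntegral.integral_add param_integrable (hat_integrable hξ hη hηR),
    integral_bracketDensity_eq_hatVariation hI hF hu hX hξ hη hξR hηR hD,
    integral_bracketDensity_eq_hatVariation hI hF hu hX hη hξ hηR hξR hD]

lemma b_toOp_gasOp (F : Fin 3 → ℝ → ℝ) (u ζ : ℝ → Pt) (x : ℝ) :
    b ((gasOp F).toOp u ζ x) = b (u x) * ∑ i, bCoeff i * scalarPart F u ζ i x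
      + translationCoeff F u ζ x * b (deriv u x) := by
  simp only [b_eq_sum ((gasOp F).toOp u ζ x), b_eq_sum (deriv u x), toOp_gasOp, Fin.sum_univ_three]
  ring

lemma sum_toOp_gasOp_mul (F : Fin 3 → ℝ → ℝ) (u ζ : ℝ → Pt) (x : ℝ) (p : Pt) :
    ∑ i, (gasOp F).toOp u ζ x i * p i = b (u x) * ∑ i, scalarPart F u ζ i x * p i
      + translationCoeff F u ζ x * ∑ i, deriv u x i * p i := by
  simp only [toOp_gasOp, Fin.sum_univ_three]
  ring

lemma sum_scalarPart_mul_hatDeriv (F : Fin 3 → ℝ → ℝ) (u ξ η : ℝ → Pt) (x : ℝ) :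
    ∑ i, scalarPart F u η i x * hatDeriv u ξ i x
      = b (deriv u x) * ∑ i, scalarPart F u η i x * ξ x i
        + b (u x) * ∑ i, scalarPart F u η i x * deriv ξ x i
        + (∑ i, bCoeff i * scalarPart F u η i x) * ∑ i, deriv u x i * ξ x i := by
  simp only [hatDeriv, Fin.sum_univ_three]
  ring

lemma param_deriv_mul_halfWronskian (F : Fin 3 → ℝ → ℝ) (u ξ η : ℝ → Pt) (i : Fin 3) (x : ℝ) :
    deriv (F i) (u x i) * deriv u x i * halfWronskian u u ξ η i x
      = scalarPart F u ξ i x * hatDeriv u η i x - scalarPart F u η i x * hatDeriv u ξ i x := by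
  simp only [scalarPart, halfWronskian]
  ring

lemma scalarPart_mul_halfWronskian_cyclic (F : Fin 3 → ℝ → ℝ) (u ξ η ζ : ℝ → Pt) (i : Fin 3)
    (x : ℝ) :
    scalarPart F u ζ i x * halfWronskian u u ξ η i x
      + scalarPart F u ξ i x * halfWronskian u u η ζ i x
      + scalarPart F u η i x * halfWronskian u u ζ ξ i x = 0 := by
  simp only [scalarPart, halfWronskian]
  ring

/-- The part of the variation of the bracket of `ξ` and `η` along `J ζ` which is symmetric in `ζ`
and `η`, and therefore drops out of the cyclic sum. -/
noncomputable def symmetricVariation (F : Fin 3 → ℝ → ℝ) (u ζ η ξ : ℝ → Pt) (x : ℝ) : ℝ :=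
  b (u x) * ((∑ i, bCoeff i * scalarPart F u ζ i x) * ∑ i, scalarPart F u η i x * ξ x i
      + (∑ i, bCoeff i * scalarPart F u η i x) * ∑ i, scalarPart F u ζ i x * ξ x i)
    - b (u x) * (translationCoeff F u ζ x * ∑ i, scalarPart F u η i x * deriv ξ x i
      + translationCoeff F u η x * ∑ i, scalarPart F u ζ i x * deriv ξ x i)
    - translationCoeff F u ζ x * translationCoeff F u η x * ∑ i, deriv u x i * deriv ξ x i

lemma symmetricVariation_comm (F : Fin 3 → ℝ → ℝ) (u ζ η ξ : ℝ → Pt) (x : ℝ) :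
    symmetricVariation F u ζ η ξ x = symmetricVariation F u η ζ ξ x := by
  unfold symmetricVariation
  ring

lemma hatVariation_toOp_gasOp (F : Fin 3 → ℝ → ℝ) (u ξ η ζ : ℝ → Pt) (x : ℝ) :
    hatVariation F u ((gasOp F).toOp u ζ) ξ η x = symmetricVariation F u ζ η ξ x
      + translationCoeff F u ζ x * ∑ i, scalarPart F u η i x * hatDeriv u ξ i x := by
  rw [hatVariation, symmetricVariation, b_toOp_gasOp, sum_toOp_gasOp_mul, sum_toOp_gasOp_mul,
    sum_scalarPart_mul_hatDeriv]
  ring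

lemma paramVariation_toOp_gasOp (F : Fin 3 → ℝ → ℝ) (u ξ η ζ : ℝ → Pt) (x : ℝ) :
    paramVariation F u ((gasOp F).toOp u ζ) ξ η x
      = b (u x) * ∑ i, deriv (F i) (u x i) * (scalarPart F u ζ i x * halfWronskian u u ξ η i x)
        + translationCoeff F u ζ x * (∑ i, scalarPart F u ξ i x * hatDeriv u η i x
          - ∑ i, scalarPart F u η i x * hatDeriv u ξ i x) := by
  rw [← Finset.sum_sub_distrib, paramVariation, Finset.mul_sum, Finset.mul_sum,
    ← Finset.sum_add_distrib]
  refine Finset.sum_congr rfl fun i _ => ?_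
  rw [← param_deriv_mul_halfWronskian, toOp_gasOp]
  ring

lemma localVariation_cyclic (F : Fin 3 → ℝ → ℝ) (u ξ η ζ : ℝ → Pt) (x : ℝ) :
    localVariation F u ((gasOp F).toOp u ζ) ξ η x + localVariation F u ((gasOp F).toOp u ξ) η ζ x
      + localVariation F u ((gasOp F).toOp u η) ζ ξ x = 0 := by
  have wronskian_sum : ∑ i, deriv (F i) (u x i) * (scalarPart F u ζ i x
        * halfWronskian u u ξ η i x)
      + ∑ i, deriv (F i) (u x i) * (scalarPart F u ξ i x * halfWronskian u u η ζ i x)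
      + ∑ i, deriv (F i) (u x i) * (scalarPart F u η i x * halfWronskian u u ζ ξ i x) = 0 := by
    simp only [← Finset.sum_add_distrib, ← mul_add, scalarPart_mul_halfWronskian_cyclic, mul_zero,
      Finset.sum_const_zero]
  simp only [localVariation, paramVariation_toOp_gasOp, hatVariation_toOp_gasOp]
  linear_combination b (u x) * wronskian_sum + symmetricVariation_comm F u ζ η ξ x
    + symmetricVariation_comm F u ξ ζ η x + symmetricVariation_comm F u η ξ ζ x

end Jacobi

/-! ### Hamiltonian operators -/

section Hamiltonian

variable {I : Fin 3 → Set ℝ} {F : Fin 3 → ℝ → ℝ} {T : Op} {u ξ η ζ X : ℝ → Pt} {R : ℝ}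

lemma exists_radius (hξ : IsTest ξ) (hη : IsTest η) (hζ : IsTest ζ) : ∃ R : ℝ,
    tsupport ξ ⊆ Set.Ioo (-R) R ∧ tsupport η ⊆ Set.Ioo (-R) R ∧ tsupport ζ ⊆ Set.Ioo (-R) R := by
  obtain ⟨r, hr⟩ := ((hξ.2.isCompact.union hη.2.isCompact).union
    hζ.2.isCompact).isBounded.subset_ball 0
  simp only [Real.ball_eq_Ioo, zero_sub, zero_add, Set.union_subset_iff] at hr
  exact ⟨r, hr.1.1, hr.1.2, hr.2⟩

/-- `T` is the operator with the parameters `F` wherever the values of the field that enter lie in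
`dom I`. No `IsField (dom I) u` is required, since the values of a perturbed field may leave `dom I`
outside of the supports of the covectors. -/
def Represents (I : Fin 3 → Set ℝ) (T : Op) (F : Fin 3 → ℝ → ℝ) : Prop :=
  ∀ u ξ, ContDiff ℝ ∞ u → IsTest ξ → (∀ y ∈ tsupport ξ, u y ∈ dom I) → ∀ x, u x ∈ dom I →
    T u ξ x = (gasOp F).toOp u ξ x

lemma represents_gasOp (F : Fin 3 → ℝ → ℝ) : Represents I (gasOp F).toOp F :=
  fun _ _ _ _ _ _ _ => rfl

lemma Represents.apply_eq (hT : Represents I T F) (hu : IsField (dom I) u) (hξ : IsTest ξ) :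
    T u ξ = (gasOp F).toOp u ξ :=
  funext fun x => hT u ξ hu.1 hξ (fun y _ => hu.2 y) x (hu.2 x)

lemma Represents.pairing_eq (hT : Represents I T F) (hu : ContDiff ℝ ∞ u) (hη : IsTest η)
    (hDξ : ∀ y ∈ tsupport ξ, u y ∈ dom I) (hDη : ∀ y ∈ tsupport η, u y ∈ dom I) :
    pairing T u ξ η = pairing (gasOp F).toOp u ξ η := by
  unfold pairing
  congr 1
  funext x
  by_cases hx : x ∈ tsupport ξ
  · rw [hT u η hu hη hDη x (hDξ x hx)]
  · simp [image_eq_zero_of_notMem_tsupport hx]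

lemma contDiff_toOp_gasOp (hI : ∀ i, IsOpen (I i)) (hF : IsParam I F) (hu : IsField (dom I) u)
    (hξ : IsTest ξ) : ContDiff ℝ ∞ ((gasOp F).toOp u ξ) :=
  contDiff_iff_contDiffAt.2 fun x =>
    contDiffAt_toOp_gasOp hI hF hu.1 hξ (fun y _ => hu.2 y) (hu.2 x)

lemma pairing_gasOp_swap (hI : ∀ i, IsOpen (I i)) (hF : IsParam I F) (hu : IsField (dom I) u)
    (hξ : IsTest ξ) (hη : IsTest η) :
    pairing (gasOp F).toOp u ξ η = -pairing (gasOp F).toOp u η ξ := by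
  obtain ⟨R, hξR, hηR, -⟩ := exists_radius hξ hη hη
  rw [pairing_gasOp hI hF hu.1 hξ hη hξR hηR fun x _ => hu.2 x,
    pairing_gasOp hI hF hu.1 hη hξ hηR hξR fun x _ => hu.2 x, ← intervalIntegral.integral_neg]
  exact intervalIntegral.integral_congr fun x _ => bracketDensity_swap F u ξ η x

lemma Represents.hasDerivAt_pairing (hI : ∀ i, IsOpen (I i)) (hF : IsParam I F)
    (hT : Represents I T F) (hu : IsField (dom I) u) (hX : ContDiff ℝ ∞ X) (hξ : IsTest ξ)
    (hη : IsTest η) (hξR : tsupport ξ ⊆ Set.Ioo (-R) R) (hηR : tsupport η ⊆ Set.Ioo (-R) R) :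
    HasDerivAt (fun ε : ℝ => pairing T (fun x => u x + ε • X x) ξ η)
      (∫ x in -R..R, localVariation F u X ξ η x) 0 := by
  rw [← integral_bracketVariation hI hF hu.1 hX hξ hη hξR hηR fun x _ => hu.2 x]
  refine (HydroType.hasDerivAt_pairing hI hF hu.1 hX hξ hη hξR hηR
    fun x _ => hu.2 x).congr_of_eventuallyEq ?_
  filter_upwards [eventually_forall_add_smul_mem (K := Set.uIcc (-R) R) (isOpen_dom hI)
    isCompact_uIcc hu.1.continuous hX.continuous fun x _ => hu.2 x] with ε hε
  exact hT.pairing_eq (hu.1.add (hX.const_smul ε)) hη (forall_tsupport_mem_dom hξR hε)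
    (forall_tsupport_mem_dom hηR hε)

lemma integral_localVariation_cyclic (hI : ∀ i, IsOpen (I i)) (hF : IsParam I F)
    (hu : IsField (dom I) u) (hξ : IsTest ξ) (hη : IsTest η) (hζ : IsTest ζ)
    (hξR : tsupport ξ ⊆ Set.Ioo (-R) R) (hηR : tsupport η ⊆ Set.Ioo (-R) R)
    (hζR : tsupport ζ ⊆ Set.Ioo (-R) R) :
    (∫ x in -R..R, localVariation F u ((gasOp F).toOp u ζ) ξ η x)
      + (∫ x in -R..R, localVariation F u ((gasOp F).toOp u ξ) η ζ x)
      + ∫ x in -R..R, localVariation F u ((gasOp F).toOp u η) ζ ξ x = 0 := by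
  have integrable := fun {θ θ' θ'' : ℝ → Pt} (hθ : IsTest θ) (hθ' : IsTest θ')
      (hθ'' : IsTest θ'') (hθR' : tsupport θ' ⊆ Set.Ioo (-R) R)
      (hθR'' : tsupport θ'' ⊆ Set.Ioo (-R) R) =>
    intervalIntegrable_localVariation hI hF hu.1 (contDiff_toOp_gasOp hI hF hu hθ) hθ' hθ'' hθR'
      hθR'' fun x _ => hu.2 x
  rw [← intervalIntegral.integral_add (integrable hζ hξ hη hξR hηR) (integrable hξ hη hζ hηR hζR),
    ← intervalIntegral.integral_add
      ((integrable hζ hξ hη hξR hηR).add (integrable hξ hη hζ hηR hζR))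
      (integrable hη hζ hξ hζR hξR)]
  simp only [localVariation_cyclic, intervalIntegral.integral_zero]

lemma Represents.isHamiltonian (hI : ∀ i, IsOpen (I i)) (hF : IsParam I F)
    (hT : Represents I T F) : IsHamiltonian (dom I) T := by
  intro u hu
  have smooth : ∀ ξ, IsTest ξ → ContDiff ℝ ∞ (T u ξ) := fun ξ hξ => by
    rw [hT.apply_eq hu hξ]
    exact contDiff_toOp_gasOp hI hF hu hξ
  refine ⟨smooth, fun ξ η hξ hη => ?_, fun ξ η ζ hξ hη hζ => ?_⟩
  · rw [hT.pairing_eq hu.1 hη (fun y _ => hu.2 y) fun y _ => hu.2 y,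
      hT.pairing_eq hu.1 hξ (fun y _ => hu.2 y) fun y _ => hu.2 y,
      pairing_gasOp_swap hI hF hu hξ hη]
  · obtain ⟨R, hξR, hηR, hζR⟩ := exists_radius hξ hη hζ
    refine ⟨_, _, _, hT.hasDerivAt_pairing hI hF hu (smooth ζ hζ) hξ hη hξR hηR,
      hT.hasDerivAt_pairing hI hF hu (smooth ξ hξ) hη hζ hηR hζR,
      hT.hasDerivAt_pairing hI hF hu (smooth η hη) hζ hξ hζR hξR, ?_⟩
    rw [hT.apply_eq hu hξ, hT.apply_eq hu hη, hT.apply_eq hu hζ]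
    exact integral_localVariation_cyclic hI hF hu hξ hη hζ hξR hηR hζR

end Hamiltonian

/-! ### Linear combinations -/

section LinearCombinations

variable {ι : Type*} [Fintype ι] {I : Fin 3 → Set ℝ} {F : Fin 3 → ℝ → ℝ} {c : ι → ℝ}
  {G : ι → Fin 3 → ℝ → ℝ} {u ξ : ℝ → Pt} {p : Pt} {x : ℝ}

lemma isParam_sum (c : ι → ℝ) (hG : ∀ m, IsParam I (G m)) :
    IsParam I fun i s => ∑ m, c m * G m i s :=
  fun i => ContDiffOn.sum fun m _ => contDiffOn_const.mul (hG m i)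

lemma deriv_param_eq_sum (hI : ∀ i, IsOpen (I i)) (hG : ∀ m, IsParam I (G m))
    (hF : ∀ i, Set.EqOn (F i) (fun s => ∑ m, c m * G m i s) (I i)) {i : Fin 3} {s : ℝ}
    (hs : s ∈ I i) : deriv (F i) s = ∑ m, c m * deriv (G m i) s := by
  have hsum := HasDerivAt.fun_sum (u := Finset.univ) fun m _ =>
    ((hG m).hasDerivAt hI hs).const_mul (c m)
  exact (hsum.congr_of_eventuallyEq ((hF i).eventuallyEq_of_mem ((hI i).mem_nhds hs))).deriv

lemma paramSum_eq_sum (hF : ∀ i, Set.EqOn (F i) (fun s => ∑ m, c m * G m i s) (I i))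
    (hp : p ∈ dom I) : paramSum F p = ∑ m, c m * paramSum (G m) p := by
  simp only [paramSum, hF _ (hp.1 _), Fin.sum_univ_three, Finset.mul_sum, ← Finset.sum_add_distrib]
  exact Finset.sum_congr rfl fun m _ => by ring

lemma tailSpeed_eq_sum (hI : ∀ i, IsOpen (I i)) (hG : ∀ m, IsParam I (G m))
    (hF : ∀ i, Set.EqOn (F i) (fun s => ∑ m, c m * G m i s) (I i)) (hp : p ∈ dom I) (i : Fin 3) :
    tailSpeed F p i = ∑ m, c m * tailSpeed (G m) p i := by
  simp only [tailSpeed_eq, deriv_param_eq_sum hI hG hF (hp.1 i), paramSum_eq_sum hF hp,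
    Finset.mul_sum, ← Finset.sum_sub_distrib]
  exact Finset.sum_congr rfl fun m _ => by ring

lemma weightedMomentum_eq_sum (hI : ∀ i, IsOpen (I i)) (hG : ∀ m, IsParam I (G m))
    (hF : ∀ i, Set.EqOn (F i) (fun s => ∑ m, c m * G m i s) (I i)) (hu : ContDiff ℝ ∞ u)
    (hξ : IsTest ξ) (hD : ∀ y ∈ tsupport ξ, u y ∈ dom I) (x : ℝ) :
    weightedMomentum F u ξ x = ∑ m, c m * weightedMomentum (G m) u ξ x := by
  simp only [weightedMomentum, ← Dinv_const_mul]
  rw [← Dinv_sum fun m => (integrable_sum_mul hξ fun y hy =>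
    contDiffAt_tailSpeed_mul_deriv hI (hG m) hu (hD y hy)).const_mul (c m)]
  congr 1
  funext y
  by_cases hy : y ∈ tsupport ξ
  · simp only [tailSpeed_eq_sum hI hG hF (hD y hy), Fin.sum_univ_three, Finset.sum_mul,
      ← Finset.sum_add_distrib]
    exact Finset.sum_congr rfl fun m _ => by ring
  · simp [image_eq_zero_of_notMem_tsupport hy]

lemma scalarPart_eq_sum (hI : ∀ i, IsOpen (I i)) (hG : ∀ m, IsParam I (G m))
    (hF : ∀ i, Set.EqOn (F i) (fun s => ∑ m, c m * G m i s) (I i)) (hx : u x ∈ dom I)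
    (ξ : ℝ → Pt) (i : Fin 3) : scalarPart F u ξ i x = ∑ m, c m * scalarPart (G m) u ξ i x := by
  simp only [scalarPart, hF i (hx.1 i), deriv_param_eq_sum hI hG hF (hx.1 i), Finset.sum_mul,
    Finset.mul_sum, ← Finset.sum_add_distrib]
  exact Finset.sum_congr rfl fun m _ => by ring

lemma translationCoeff_eq_sum (hI : ∀ i, IsOpen (I i)) (hG : ∀ m, IsParam I (G m))
    (hF : ∀ i, Set.EqOn (F i) (fun s => ∑ m, c m * G m i s) (I i)) (hu : ContDiff ℝ ∞ u)
    (hξ : IsTest ξ) (hD : ∀ y ∈ tsupport ξ, u y ∈ dom I) (hx : u x ∈ dom I) :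
    translationCoeff F u ξ x = ∑ m, c m * translationCoeff (G m) u ξ x := by
  simp only [translationCoeff, hF _ (hx.1 _), weightedMomentum_eq_sum hI hG hF hu hξ hD,
    paramSum_eq_sum hF hx, Fin.sum_univ_three, Finset.sum_mul, Finset.mul_sum,
    ← Finset.sum_add_distrib, ← Finset.sum_sub_distrib]
  exact Finset.sum_congr rfl fun m _ => by ring

lemma represents_sum (hI : ∀ i, IsOpen (I i)) (hG : ∀ m, IsParam I (G m))
    (hF : ∀ i, Set.EqOn (F i) (fun s => ∑ m, c m * G m i s) (I i)) :
    Represents I (∑ m, c m • (gasOp (G m)).toOp) F := by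
  intro u ξ hu hξ hD x hx
  funext i
  simp only [Finset.sum_apply, Pi.smul_apply, smul_eq_mul, toOp_gasOp,
    scalarPart_eq_sum hI hG hF hx, translationCoeff_eq_sum hI hG hF hu hξ hD hx, Finset.mul_sum,
    ← Finset.sum_add_distrib]
  exact Finset.sum_congr rfl fun m _ => by ring

lemma areCompatible_gasOp {F G : Fin 3 → ℝ → ℝ} (hI : ∀ i, IsOpen (I i)) (hF : IsParam I F)
    (hG : IsParam I G) : AreCompatible (dom I) (gasOp F).toOp (gasOp G).toOp := by
  intro c c'
  have isParam_pair : ∀ m, IsParam I ((![F, G] : Fin 2 → Fin 3 → ℝ → ℝ) m) :=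
    Fin.forall_fin_two.2 ⟨hF, hG⟩
  have combination :=
    (represents_sum hI (c := ![c, c']) isParam_pair fun i s _ => rfl).isHamiltonian hI
      (isParam_sum _ isParam_pair)
  rwa [Fin.sum_univ_two] at combination

lemma Represents.restrict_eq {T : Op} (hT : Represents I T F) :
    restrict (dom I) T = restrict (dom I) (gasOp F).toOp :=
  funext fun u => funext fun ξ => hT.apply_eq u.2 ξ.2

lemma sum_smul_restrict (D : Set Pt) (c : ι → ℝ) (T : ι → Op) :
    ∑ m, c m • restrict D (T m) = restrict D (∑ m, c m • T m) := by
  funext u ξ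
  simp [restrict, Finset.sum_apply]

end LinearCombinations

/-! ### Different parameters give different operators -/

section Injectivity

variable {I : Fin 3 → Set ℝ} {F G : Fin 3 → ℝ → ℝ} {p : Pt} {i j : Fin 3} {s t : ℝ}

lemma forall_update_mem (hp : ∀ i, p i ∈ I i) (ht : t ∈ I j) (i : Fin 3) :
    Function.update p j t i ∈ I i := by
  rcases eq_or_ne i j with rfl | hij
  · simpa using ht
  · simpa [hij] using hp i

lemma b_update (p : Pt) (j : Fin 3) (t : ℝ) :
    b (Function.update p j t) = b p + bCoeff j * (t - p j) := by
  fin_cases j <;> simp [b, bCoeff, Function.update] <;> ring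

lemma bCoeff_ne_zero (j : Fin 3) : bCoeff j ≠ 0 := by
  fin_cases j <;> simp [bCoeff]

lemma exists_mem_ne_of_isOpen {s : Set ℝ} (hs : IsOpen s) {x : ℝ} (hx : x ∈ s) :
    ∃ t ∈ s, t ≠ x :=
  Filter.nonempty_of_mem (inter_mem (mem_nhdsWithin_of_mem_nhds (hs.mem_nhds hx))
    (self_mem_nhdsWithin (a := x) (s := {x}ᶜ)))

lemma exists_update_mem_dom (hI : ∀ i, IsOpen (I i)) (hp : ∀ i, p i ∈ I i) (j : Fin 3) :
    ∃ t, Function.update p j t ∈ dom I := by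
  by_cases hb : b p = 0
  · obtain ⟨t, ht, hne⟩ := exists_mem_ne_of_isOpen (hI j) (hp j)
    refine ⟨t, forall_update_mem hp ht, ?_⟩
    rw [b_update, hb, zero_add]
    exact mul_ne_zero (bCoeff_ne_zero j) (sub_ne_zero.2 hne)
  · exact ⟨p j, forall_update_mem hp (hp j), by rwa [Function.update_eq_self]⟩

lemma exists_mem_dom_pair (hI : ∀ i, IsOpen (I i)) (hne : ∀ i, (I i).Nonempty) (hij : i ≠ j)
    (hs : s ∈ I i) (ht : t ∈ I j) : ∃ p ∈ dom I, p i = s ∧ p j = t := by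
  choose q hq using hne
  obtain ⟨k, hki, hkj⟩ : ∃ k : Fin 3, k ≠ i ∧ k ≠ j := by
    clear hs ht
    revert i j
    decide
  obtain ⟨r, hr⟩ := exists_update_mem_dom hI (forall_update_mem (forall_update_mem hq hs) ht) k
  exact ⟨_, hr, by simp [hki.symm, hij], by simp [hkj.symm]⟩

lemma exists_mem_dom (hI : ∀ i, IsOpen (I i)) (hne : ∀ i, (I i).Nonempty) (hs : s ∈ I i) :
    ∃ p ∈ dom I, p i = s := by
  obtain ⟨j, hij⟩ := exists_ne i
  obtain ⟨t, ht⟩ := hne j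
  obtain ⟨p, hp, hpi, -⟩ := exists_mem_dom_pair hI hne hij.symm hs ht
  exact ⟨p, hp, hpi⟩

lemma exists_isTest_deriv_eq_one : ∃ ξ : ℝ → Pt, IsTest ξ ∧ ∀ i, deriv ξ 0 i = 1 := by
  let φ : ContDiffBump (0 : ℝ) := ⟨1, 2, one_pos, one_lt_two⟩
  have hφ : ContDiff ℝ ∞ φ := φ.contDiff
  refine ⟨fun y _ => y * φ y, ⟨contDiff_pi.2 fun _ => contDiff_id.mul hφ,
    φ.hasCompactSupport.mono fun y hy hφy => hy (funext fun i => by simp [hφy])⟩, fun i => ?_⟩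
  have deriv_component : HasDerivAt (fun y : ℝ => y * φ y) 1 0 := by
    refine ((hasDerivAt_id (0 : ℝ)).mul
      (hφ.differentiable (by simp) 0).hasDerivAt).congr_deriv ?_
    simp [φ.one_of_mem_closedBall (x := 0) (by simp [φ])]
  rw [(hasDerivAt_pi.2 fun _ => deriv_component : HasDerivAt (fun y _ => y * φ y) _ 0).deriv]

lemma isField_const {D : Set Pt} (hp : p ∈ D) : IsField D fun _ => p :=
  ⟨contDiff_const, fun _ => hp⟩

lemma toOp_gasOp_const (F : Fin 3 → ℝ → ℝ) (p : Pt) (ξ : ℝ → Pt) (x : ℝ) (i : Fin 3) :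
    (gasOp F).toOp (fun _ => p) ξ x i = b p ^ 2 * F i (p i) * deriv ξ x i := by
  have b_zero : b 0 = 0 := by simp [b]
  simp only [toOp_gasOp, scalarPart, hatDeriv, deriv_const, b_zero, Pi.zero_apply, zero_mul,
    mul_zero, Finset.sum_const_zero, add_zero, zero_add]
  ring

lemma eqOn_of_restrict_eq (hI : ∀ i, IsOpen (I i)) (hne : ∀ i, (I i).Nonempty)
    (h : restrict (dom I) (gasOp F).toOp = restrict (dom I) (gasOp G).toOp) (i : Fin 3) :
    Set.EqOn (F i) (G i) (I i) := by
  intro s hs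
  obtain ⟨p, hp, rfl⟩ := exists_mem_dom hI hne hs
  obtain ⟨ξ, hξ, hξ'⟩ := exists_isTest_deriv_eq_one
  have hconst := congrFun (congrFun (congrFun (congrFun h ⟨_, isField_const hp⟩) ⟨ξ, hξ⟩) 0) i
  simp only [restrict, toOp_gasOp_const, hξ', mul_one] at hconst
  exact mul_left_cancel₀ (pow_ne_zero 2 hp.2) hconst

end Injectivity

/-! ### Commuting flows -/

section CommutingFlows

variable {I : Fin 3 → Set ℝ} {F : Fin 3 → ℝ → ℝ}

/-- The derivative of `tailSpeed F` at `p` in the direction `q`. -/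
noncomputable def tailSpeedVariation (F : Fin 3 → ℝ → ℝ) (p q : Pt) : Pt := fun i =>
  b q / 2 * bCoeff i * deriv (F i) (p i) + b p / 2 * bCoeff i * (deriv (deriv (F i)) (p i) * q i)
    - (1 / 2) * ∑ j, bCoeff j ^ 2 * (deriv (F j) (p j) * q j)

lemma hasDerivAt_tailSpeed_comp (hI : ∀ i, IsOpen (I i)) (hF : IsParam I F) {γ : ℝ → Pt} {q : Pt}
    {t : ℝ} (hγ : HasDerivAt γ q t) (ht : γ t ∈ dom I) (i : Fin 3) :
    HasDerivAt (fun ε => tailSpeed F (γ ε) i) (tailSpeedVariation F (γ t) q i) t := by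
  have hγj := hasDerivAt_pi.1 hγ
  have hb : HasDerivAt (fun ε => b (γ ε)) (b q) t :=
    (((hγj 2).const_mul 2).add (hγj 1)).sub (hγj 0)
  have hFγ : ∀ j, HasDerivAt (fun ε => F j (γ ε j)) (deriv (F j) (γ t j) * q j) t := fun j =>
    (hF.hasDerivAt hI (ht.1 j)).comp t (hγj j)
  have hF'γ : HasDerivAt (fun ε => deriv (F i) (γ ε i)) (deriv (deriv (F i)) (γ t i) * q i) t :=
    HasDerivAt.comp (h₂ := deriv (F i)) t
      ((hF.contDiffAt_deriv hI (ht.1 i)).differentiableAt (by simp)).hasDerivAt (hγj i)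
  simp only [tailSpeed_eq, paramSum]
  exact (((hb.div_const 2).mul_const (bCoeff i)).mul hF'γ).sub
    ((HasDerivAt.fun_sum fun j _ => (hFγ j).const_mul (bCoeff j ^ 2)).const_mul (1 / 2))

lemma hasDerivAt_speed_comp {γ : ℝ → Pt} {q : Pt} {t : ℝ} (hγ : HasDerivAt γ q t) (i : Fin 3) :
    HasDerivAt (fun ε => speed (γ ε) i) (speed q i) t := by
  have hγj := hasDerivAt_pi.1 hγ
  fin_cases i
  · exact (hγj 1).add (hγj 2)
  · exact (hγj 0).sub (hγj 2)
  · exact ((hγj 0).add (hγj 1)).div_const 2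

lemma hasDerivAt_flow_add_smul {V : Pt → Pt} {u X : ℝ → Pt} {u' X' : Pt} {x v' : ℝ} {i : Fin 3}
    (hu : HasDerivAt u u' x) (hX : HasDerivAt X X' x)
    (hV : HasDerivAt (fun ε : ℝ => V (u x + ε • X x) i) v' 0) :
    HasDerivAt (fun ε : ℝ => flow V (fun y => u y + ε • X y) x i)
      (v' * u' i + V (u x) i * X' i) 0 := by
  have hderiv : ∀ ε : ℝ, deriv (fun y => u y + ε • X y) x = u' + ε • X' := fun ε =>
    (hu.add (hX.const_smul ε)).deriv
  have hline : HasDerivAt (fun ε : ℝ => (u' + ε • X') i) (X' i) 0 := by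
    simpa using ((hasDerivAt_id (0 : ℝ)).mul_const (X' i)).const_add (u' i)
  simpa only [flow, hderiv, zero_smul, add_zero] using! hV.mul hline

lemma speed_add_speed_mul_tailSpeedVariation (F : Fin 3 → ℝ → ℝ) (p q : Pt) (i : Fin 3) :
    speed (tailSpeed F p * q) i + speed p i * tailSpeedVariation F p q i =
      tailSpeedVariation F p (speed p * q) i + tailSpeed F p i * speed q i := by
  fin_cases i <;>
    simp [speed, tailSpeed_eq, tailSpeedVariation, paramSum, bCoeff, Fin.sum_univ_three, b] <;> ring

lemma flowsCommute_tailSpeed (hI : ∀ i, IsOpen (I i)) (hF : IsParam I F) :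
    FlowsCommute (dom I) speed (tailSpeed F) := by
  intro u ⟨hu, hD⟩ x i
  have hux : HasDerivAt u (deriv u x) x := ((contDiff_infty_iff_deriv.1 hu).1 x).hasDerivAt
  have huxx := hasDerivAt_component (contDiff_infty_iff_deriv.1 hu).2
  have flow_tailSpeed : HasDerivAt (flow (tailSpeed F) u) _ x := hasDerivAt_pi.2 fun j =>
    (hasDerivAt_tailSpeed_comp hI hF hux (hD x) j).mul (huxx j x)
  have flow_speed : HasDerivAt (flow speed u) _ x := hasDerivAt_pi.2 fun j =>
    (hasDerivAt_speed_comp hux j).mul (huxx j x)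
  have line : ∀ q : Pt, HasDerivAt (fun ε : ℝ => u x + ε • q) q 0 := fun q => by
    simpa using ((hasDerivAt_id (0 : ℝ)).smul_const q).const_add (u x)
  have line_zero : ∀ q : Pt, u x + (0 : ℝ) • q = u x := by simp
  have speed_variation := hasDerivAt_flow_add_smul hux flow_tailSpeed
    (hasDerivAt_speed_comp (line (flow (tailSpeed F) u x)) i)
  have tailSpeed_variation := hasDerivAt_flow_add_smul hux flow_speed
    (hasDerivAt_tailSpeed_comp hI hF (line (flow speed u x)) ((line_zero _).symm ▸ hD x) i)
  refine ⟨_, speed_variation, tailSpeed_variation.congr_deriv ?_⟩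
  have symmetry : speed (flow (tailSpeed F) u x) i +
      speed (u x) i * tailSpeedVariation F (u x) (deriv u x) i =
        tailSpeedVariation F (u x) (flow speed u x) i + tailSpeed F (u x) i * speed (deriv u x) i :=
    speed_add_speed_mul_tailSpeedVariation F (u x) (deriv u x) i
  rw [line_zero]
  linear_combination -deriv u x i * symmetry

end CommutingFlows

/-! ### Gas dynamics -/

section GasDynamics

variable {ρ c s : ℝ × ℝ → ℝ} {z : ℝ × ℝ}

lemma hasFDerivAt_one_div (hρ : DifferentiableAt ℝ ρ z) (h0 : ρ z ≠ 0) :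
    HasFDerivAt (fun y => 1 / ρ y) (-(1 / ρ z) ^ 2 • fderiv ℝ ρ z) z := by
  have hinv := (hasDerivAt_inv h0).comp_hasFDerivAt z hρ.hasFDerivAt
  simpa only [one_div, inv_pow] using! hinv

lemma gasEquations_iff_of_mul_eq_one {r σ c s r_t r_x c_t c_x s_t s_x : ℝ} (h : r * σ = 1) :
    (r_t + (r * c_x + c * r_x) = 0 ∧ c_t + c * c_x + σ * (s_x + σ ^ 2 * r_x) = 0 ∧
        s_t + c * s_x = 0) ↔
      -c_t + s_t + σ ^ 2 * r_t = (-c - s + σ + s) * (-c_x + s_x + σ ^ 2 * r_x) ∧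
      -c_t - s_t + -(σ ^ 2 * r_t) = (-c + s - σ - s) * (-c_x - s_x + -(σ ^ 2 * r_x)) ∧
      s_t = (-c + s - σ + (-c - s + σ)) / 2 * s_x := by
  constructor
  · rintro ⟨continuity, momentum, entropy⟩
    refine ⟨?_, ?_, ?_⟩
    · linear_combination -momentum + entropy + σ ^ 2 * continuity - σ * c_x * h
    · linear_combination -momentum - entropy - σ ^ 2 * continuity + σ * c_x * h
    · linear_combination entropy
  · rintro ⟨hu, hv, hw⟩
    refine ⟨?_, ?_, ?_⟩
    · linear_combination r ^ 2 * ((hu - hv) / 2 - hw) + r ^ 2 * σ * c_x * h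
        - (r * σ + 1) * (r_t + r * c_x + c * r_x) * h
    · linear_combination -(hu + hv) / 2
    · linear_combination hw

lemma gasEquations_iff (hρ : DifferentiableAt ℝ ρ z) (hc : DifferentiableAt ℝ c z)
    (hs : DifferentiableAt ℝ s z) (h0 : ρ z ≠ 0) :
    GasEquations ρ c s z ↔
      RiemannEquations ![fun y => -c y + s y - 1 / ρ y, fun y => -c y - s y + 1 / ρ y, s] z := by
  have fderiv_one_div := hasFDerivAt_one_div hρ h0
  have fderiv_mul : fderiv ℝ (fun y => ρ y * c y) z = _ := fderiv_fun_mul hρ hc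
  have fderiv_pressure : fderiv ℝ (fun y => s y - 1 / ρ y) z = _ :=
    (hs.hasFDerivAt.sub fderiv_one_div).fderiv
  have fderiv_u : fderiv ℝ (fun y => -c y + s y - 1 / ρ y) z = _ :=
    ((hc.hasFDerivAt.neg.add hs.hasFDerivAt).sub fderiv_one_div).fderiv
  have fderiv_v : fderiv ℝ (fun y => -c y - s y + 1 / ρ y) z = _ :=
    ((hc.hasFDerivAt.neg.sub hs.hasFDerivAt).add fderiv_one_div).fderiv
  have hσ : ρ z * (1 / ρ z) = 1 := mul_one_div_cancel h0
  simpa [GasEquations, RiemannEquations, dt, dx, Fin.forall_fin_succ, speed, fderiv_mul,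
    fderiv_pressure, fderiv_u, fderiv_v, -one_div] using gasEquations_iff_of_mul_eq_one hσ

end GasDynamics

/-! ### Calculus of partial derivatives -/

/-- `h` is differentiable at `p` with the partial derivatives `d k`. -/
def HasPd (h : Pt → ℝ) (d : Pt) (p : Pt) : Prop :=
  HasFDerivAt h (∑ k, d k • ContinuousLinearMap.proj (R := ℝ) (φ := fun _ : Fin 3 => ℝ) k) p

namespace HasPd

variable {h g : Pt → ℝ} {d e p : Pt}

lemma pd_eq (H : HasPd h d p) (k : Fin 3) : pd k h p = d k := by
  rw [pd, HasFDerivAt.fderiv H, sum_apply, Finset.sum_eq_single k]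
  · simp
  · intro l _ hl
    simp [hl]
  · simp

lemma congr (H : HasPd h d p) (hd : ∀ k, d k = e k) : HasPd h e p := by
  rwa [← show d = e from funext hd]

lemma const (c : ℝ) : HasPd (fun _ => c) (fun _ => 0) p :=
  (hasFDerivAt_const c p).congr_fderiv (by simp)

lemma coord (i : Fin 3) : HasPd (fun q => q i) (fun k => if k = i then 1 else 0) p :=
  (ContinuousLinearMap.proj (R := ℝ) (φ := fun _ : Fin 3 => ℝ) i).hasFDerivAt.congr_fderiv
    (by ext v; simp)

lemma add (H : HasPd h d p) (H' : HasPd g e p) :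
    HasPd (fun q => h q + g q) (fun k => d k + e k) p :=
  (HasFDerivAt.add H H').congr_fderiv (by simp [add_smul, Finset.sum_add_distrib])

lemma mul (H : HasPd h d p) (H' : HasPd g e p) :
    HasPd (fun q => h q * g q) (fun k => d k * g p + h p * e k) p :=
  (HasFDerivAt.mul H H').congr_fderiv (by
    ext v
    simp only [add_apply, smul_apply, smul_eq_mul,
      ContinuousLinearMap.proj_apply, Fin.sum_univ_three]
    ring)

lemma const_mul (c : ℝ) (H : HasPd h d p) : HasPd (fun q => c * h q) (fun k => c * d k) p :=
  ((const c).mul H).congr fun k => by ring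

lemma neg (H : HasPd h d p) : HasPd (fun q => -h q) (fun k => -d k) p := by
  simpa using H.const_mul (-1)

lemma sub (H : HasPd h d p) (H' : HasPd g e p) :
    HasPd (fun q => h q - g q) (fun k => d k - e k) p := by
  simpa [sub_eq_add_neg] using H.add H'.neg

lemma comp {φ : ℝ → ℝ} {φ' : ℝ} (hφ : HasDerivAt φ φ' (h p)) (H : HasPd h d p) :
    HasPd (fun q => φ (h q)) (fun k => φ' * d k) p :=
  (hφ.comp_hasFDerivAt p H).congr_fderiv (by
    rw [Finset.smul_sum]
    exact Finset.sum_congr rfl fun k _ => smul_smul _ _ _)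

lemma comp_coord {φ : ℝ → ℝ} {φ' : ℝ} {i : Fin 3} (hφ : HasDerivAt φ φ' (p i)) :
    HasPd (fun q => φ (q i)) (fun k => if k = i then φ' else 0) p :=
  (comp (h := fun q => q i) hφ (coord i)).congr fun k => by simp

lemma inv (H : HasPd h d p) (h0 : h p ≠ 0) :
    HasPd (fun q => (h q)⁻¹) (fun k => -(h p ^ 2)⁻¹ * d k) p :=
  comp (hasDerivAt_inv h0) H

lemma comp_curve {γ : ℝ → Pt} {v : Pt} {t : ℝ} (H : HasPd h d (γ t)) (hγ : HasDerivAt γ v t) :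
    HasDerivAt (fun s => h (γ s)) (∑ k, d k * v k) t :=
  (HasFDerivAt.comp_hasDerivAt t H hγ).congr_deriv (by simp)

end HasPd

lemma hasPd_b {p : Pt} : HasPd b bCoeff p :=
  (((HasPd.coord 2).const_mul 2).add (HasPd.coord 1) |>.sub (HasPd.coord 0)).congr fun k => by
    fin_cases k <;> simp [bCoeff]

lemma pd_congr {h g : Pt → ℝ} {p : Pt} (hg : h =ᶠ[𝓝 p] g) (k : Fin 3) : pd k h p = pd k g p := by
  rw [pd, hg.fderiv_eq, pd]

section ParamPd

variable {I : Fin 3 → Set ℝ} {F : Fin 3 → ℝ → ℝ} {p : Pt}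

lemma IsParam.hasPd (hI : ∀ i, IsOpen (I i)) (hF : IsParam I F) (hp : p ∈ dom I) (i : Fin 3) :
    HasPd (fun q => F i (q i)) (fun k => if k = i then deriv (F i) (p i) else 0) p :=
  HasPd.comp_coord (hF.hasDerivAt hI (hp.1 i))

lemma IsParam.hasPd_deriv (hI : ∀ i, IsOpen (I i)) (hF : IsParam I F) (hp : p ∈ dom I)
    (i : Fin 3) : HasPd (fun q => deriv (F i) (q i))
      (fun k => if k = i then deriv (deriv (F i)) (p i) else 0) p :=
  HasPd.comp_coord (φ := deriv (F i))
    ((hF.contDiffAt_deriv hI (hp.1 i)).differentiableAt (by simp)).hasDerivAt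

lemma IsNondegParam.ne_zero (hF : IsNondegParam I F) (hp : p ∈ dom I) (i : Fin 3) :
    F i (p i) ≠ 0 :=
  hF.2 i _ (hp.1 i)

end ParamPd

/-! ### Diagonal metrics -/

section DiagonalMetrics

variable {g : Pt → Matrix (Fin 3) (Fin 3) ℝ} {p : Pt}

lemma inv_diagonal_of_ne_zero {n K : Type*} [Fintype n] [DecidableEq n] [Field K] {d : n → K}
    (hd : ∀ k, d k ≠ 0) : (Matrix.diagonal d)⁻¹ = Matrix.diagonal fun k => (d k)⁻¹ :=
  Matrix.inv_eq_left_inv <| by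
    rw [Matrix.diagonal_mul_diagonal, ← Matrix.diagonal_one]
    exact congrArg Matrix.diagonal (funext fun k => inv_mul_cancel₀ (hd k))

lemma christoffel_diagonal {d : Fin 3 → Pt → ℝ} {e : Fin 3 → Pt}
    (hg : ∀ᶠ q in 𝓝 p, g q = Matrix.diagonal fun l => d l q)
    (hd : ∀ l, HasPd (d l) (e l) p) (h0 : ∀ l, d l p ≠ 0) (k i j : Fin 3) :
    christoffel g k i j p = (1 / 2) * ((d k p)⁻¹ * ((if k = j then e k i else 0)
      + (if k = i then e k j else 0) - if i = j then e i k else 0)) := by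
  have pd_entry : ∀ m l n, pd m (fun q => g q l n) p = if l = n then e l m else 0 := by
    intro m l n
    rw [pd_congr (g := fun q => (Matrix.diagonal fun l => d l q) l n)
      (hg.mono fun q hq => by rw [hq])]
    split_ifs with h
    · subst h
      simpa using (hd l).pd_eq m
    · simpa [Matrix.diagonal_apply_ne _ h] using (HasPd.const (p := p) 0).pd_eq m
  simp only [christoffel, pd_entry, hg.self_of_nhds, inv_diagonal_of_ne_zero h0]
  rw [Finset.sum_eq_single k (fun l _ hl => by simp [Matrix.diagonal_apply_ne _ hl.symm])
    (fun h => absurd (Finset.mem_univ k) h), Matrix.diagonal_apply_eq]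

section CompCoord

variable {V : Set Pt} {φ : Fin 3 → ℝ → ℝ}

lemma christoffel_diagonal_comp_coord (hV : IsOpen V)
    (hφ : ∀ q ∈ V, ∀ l, DifferentiableAt ℝ (φ l) (q l)) (h0 : ∀ q ∈ V, ∀ l, φ l (q l) ≠ 0)
    (hg : ∀ q ∈ V, g q = Matrix.diagonal fun l => φ l (q l)) (hp : p ∈ V) (k i j : Fin 3) :
    christoffel g k i j p =
      if k = i ∧ k = j then (1 / 2) * ((φ k (p k))⁻¹ * deriv (φ k) (p k)) else 0 := by
  have hd : ∀ l, HasPd (fun q => φ l (q l)) _ p := fun l =>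
    HasPd.comp_coord (hφ p hp l).hasDerivAt
  rw [christoffel_diagonal (eventually_of_mem (hV.mem_nhds hp) hg) hd (h0 p hp)]
  fin_cases k <;> fin_cases i <;> fin_cases j <;> simp

lemma isFlatOn_diagonal_comp_coord (hV : IsOpen V)
    (hφ : ∀ q ∈ V, ∀ l, ContDiffAt ℝ 2 (φ l) (q l)) (h0 : ∀ q ∈ V, ∀ l, φ l (q l) ≠ 0)
    (hg : ∀ q ∈ V, g q = Matrix.diagonal fun l => φ l (q l)) : IsFlatOn g V := by
  intro q hq i j k l
  have hφ' : ∀ r ∈ V, ∀ l, DifferentiableAt ℝ (φ l) (r l) := fun r hr l =>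
    (hφ r hr l).differentiableAt two_ne_zero
  have christoffel_eq {r : Pt} (hr : r ∈ V) := christoffel_diagonal_comp_coord hV hφ' h0 hg hr
  let χ : Fin 3 → ℝ → ℝ := fun l s => (1 / 2) * ((φ l s)⁻¹ * deriv (φ l) s)
  have hχ : ∀ l, DifferentiableAt ℝ (χ l) (q l) := fun l =>
    (((hφ' q hq l).inv (h0 q hq l)).mul
      (((hφ q hq l).derivWithin (m := 1) le_rfl).differentiableAt one_ne_zero)).const_mul _
  have pd_christoffel : ∀ m k i j, pd m (christoffel g k i j) q =
      if k = i ∧ k = j ∧ k = m then deriv (χ k) (q k) else 0 := by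
    intro m k i j
    rw [pd_congr (eventually_of_mem (hV.mem_nhds hq) fun r hr => christoffel_eq hr k i j)]
    rcases em (k = i ∧ k = j) with ⟨rfl, rfl⟩ | h
    · simpa [χ, eq_comm (a := k)] using! (HasPd.comp_coord (hχ k).hasDerivAt).pd_eq m
    · simpa only [h, ← and_assoc, false_and, if_false] using (HasPd.const (p := q) 0).pd_eq m
  simp only [riemann, pd_christoffel, christoffel_eq hq, Fin.sum_univ_three]
  fin_cases i <;> fin_cases j <;> fin_cases k <;> fin_cases l <;> simp

end CompCoord

end DiagonalMetrics

/-! ### The connection of the gas metric -/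

section GasMetric

variable {I : Fin 3 → Set ℝ} {F : Fin 3 → ℝ → ℝ} {p : Pt}

/-- The Christoffel symbols of `gasMetric F` in closed form. -/
noncomputable def gasChristoffel (F : Fin 3 → ℝ → ℝ) (k i j : Fin 3) (p : Pt) : ℝ :=
  -((if k = j then bCoeff i else 0) + (if k = i then bCoeff j else 0)) * (b p)⁻¹
    + (if i = j then bCoeff k else 0) * (F k (p k) * ((F i (p i))⁻¹ * (b p)⁻¹))
    - (if i = j ∧ i = k then 1 / 2 else 0) * (deriv (F i) (p i) * (F i (p i))⁻¹)

lemma gasMetric_entry_ne_zero (hF : IsNondegParam I F) (hp : p ∈ dom I) (i : Fin 3) :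
    (b p ^ 2)⁻¹ * (F i (p i))⁻¹ ≠ 0 :=
  mul_ne_zero (inv_ne_zero (pow_ne_zero 2 hp.2)) (inv_ne_zero (hF.ne_zero hp i))

lemma inv_gasMetric (hF : IsNondegParam I F) (hp : p ∈ dom I) :
    (gasMetric F p)⁻¹ = Matrix.diagonal fun i => b p ^ 2 * F i (p i) := by
  rw [gasMetric, inv_diagonal_of_ne_zero (gasMetric_entry_ne_zero hF hp)]
  simp only [mul_inv, inv_inv]

lemma christoffel_gasMetric (hI : ∀ i, IsOpen (I i)) (hF : IsNondegParam I F) (hp : p ∈ dom I)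
    (k i j : Fin 3) : christoffel (gasMetric F) k i j p = gasChristoffel F k i j p := by
  have hb : b p ≠ 0 := hp.2
  have hF0 := hF.ne_zero hp
  have hasPd_entry : ∀ l, HasPd (fun q => (b q ^ 2)⁻¹ * (F l (q l))⁻¹) _ p := fun l =>
    ((HasPd.comp (hasDerivAt_pow 2 (b p)) hasPd_b).inv (pow_ne_zero 2 hb)).mul
      ((hF.1.hasPd hI hp l).inv (hF0 l))
  rw [christoffel_diagonal (g := gasMetric F) (Eventually.of_forall fun q => rfl) hasPd_entry
    (gasMetric_entry_ne_zero hF hp), gasChristoffel]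
  have hf := hF0 0
  have hφ := hF0 1
  have hψ := hF0 2
  fin_cases k <;> fin_cases i <;> fin_cases j <;> simp <;> field_simp <;> ring

lemma isGeneratedBy_gasMetric (hI : ∀ i, IsOpen (I i)) (hF : IsNondegParam I F) :
    (gasOp F).IsGeneratedBy (gasMetric F) (dom I) := by
  intro p hp
  refine ⟨?_, Matrix.isSymm_diagonal _, (inv_gasMetric hF hp).symm, fun X i j => ?_⟩
  · rw [gasMetric, Matrix.det_diagonal, isUnit_iff_ne_zero]
    exact Finset.prod_ne_zero_iff.2 fun i _ => gasMetric_entry_ne_zero hF hp i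
  · rw [inv_gasMetric hF hp,
      Finset.sum_eq_single i (fun s _ hs => by simp [Matrix.diagonal_apply_ne _ hs.symm])
        (fun h => absurd (Finset.mem_univ i) h)]
    simp only [christoffel_gasMetric hI hF hp, Matrix.diagonal_apply_eq, Fin.sum_univ_three,
      gasChristoffel]
    have hb : b p ≠ 0 := hp.2
    have hf := hF.ne_zero hp 0
    have hφ := hF.ne_zero hp 1
    have hψ := hF.ne_zero hp 2
    fin_cases i <;> fin_cases j <;> simp [gasOp, bCoeff] <;> field_simp <;> ring

lemma isConformallyFlatOn_gasMetric (hI : ∀ i, IsOpen (I i)) (hF : IsNondegParam I F) :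
    IsConformallyFlatOn (gasMetric F) (dom I) := by
  intro p hp
  refine ⟨dom I, isOpen_dom hI, hp, subset_rfl, fun q => b q ^ 2, (contDiff_b.pow 2).contDiffOn,
    fun q hq => sq_pos_of_ne_zero hq.2, ?_⟩
  refine isFlatOn_diagonal_comp_coord (φ := fun l s => (F l s)⁻¹) (isOpen_dom hI)
    (fun q hq l => contDiffAt_infty.1 ((hF.1.contDiffAt hI (hq.1 l)).inv (hF.ne_zero hq l)) 2)
    (fun q hq l => inv_ne_zero (hF.ne_zero hq l)) fun q hq => ?_
  rw [gasMetric, ← Matrix.diagonal_smul]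
  exact congrArg Matrix.diagonal (funext fun l => mul_inv_cancel_left₀ (pow_ne_zero 2 hq.2) _)

/-! ### Curvature -/

lemma pd_christoffel_gasMetric (hI : ∀ i, IsOpen (I i)) (hF : IsNondegParam I F) (hp : p ∈ dom I)
    (m k i j : Fin 3) : pd m (christoffel (gasMetric F) k i j) p =
      -((if k = j then bCoeff i else 0) + (if k = i then bCoeff j else 0))
          * (-(b p ^ 2)⁻¹ * bCoeff m)
        + (if i = j then bCoeff k else 0) * ((if m = k then deriv (F k) (p k) else 0)
            * ((F i (p i))⁻¹ * (b p)⁻¹)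
          + F k (p k) * ((-(F i (p i) ^ 2)⁻¹ * if m = i then deriv (F i) (p i) else 0) * (b p)⁻¹
            + (F i (p i))⁻¹ * (-(b p ^ 2)⁻¹ * bCoeff m)))
        - (if i = j ∧ i = k then 1 / 2 else 0)
          * ((if m = i then deriv (deriv (F i)) (p i) else 0) * (F i (p i))⁻¹
          + deriv (F i) (p i)
            * (-(F i (p i) ^ 2)⁻¹ * if m = i then deriv (F i) (p i) else 0)) := by
  have hasPd_inv_b : HasPd (fun q => (b q)⁻¹) _ p := hasPd_b.inv hp.2
  have hasPd_inv := (hF.1.hasPd hI hp i).inv (hF.ne_zero hp i)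
  rw [pd_congr (g := gasChristoffel F k i j) (eventually_of_mem ((isOpen_dom hI).mem_nhds hp)
    fun q hq => christoffel_gasMetric hI hF hq k i j)]
  exact (((hasPd_inv_b.const_mul _).add
    (((hF.1.hasPd hI hp k).mul (hasPd_inv.mul hasPd_inv_b)).const_mul _)).sub
      (((hF.1.hasPd_deriv hI hp i).mul hasPd_inv).const_mul _)).pd_eq m

lemma riemann_swap (g : Pt → Matrix (Fin 3) (Fin 3) ℝ) (i j k l : Fin 3) (p : Pt) :
    riemann g i j l k p = -riemann g i j k l p := by
  simp only [riemann, Finset.sum_sub_distrib]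
  ring

set_option maxHeartbeats 800000 in
-- 27 components, each a rational identity
lemma riemann_gasMetric (hI : ∀ i, IsOpen (I i)) (hF : IsNondegParam I F) (hp : p ∈ dom I)
    (i j k l : Fin 3) :
    riemann (gasMetric F) i j k l p = (tailSpeed F p i + tailSpeed F p j)
      * ((b p ^ 2)⁻¹ * (F j (p j))⁻¹)
      * ((if i = k ∧ j = l then 1 else 0) - if i = l ∧ j = k then 1 else 0) := by
  wlog hkl : k < l generalizing k l
  · rcases (not_lt.1 hkl).eq_or_lt with rfl | hlk
    · simp [riemann]
    · rw [riemann_swap, this l k hlk]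
      ring
  -- In terms of the flat metric `b² • gasMetric F`, `w^i = b ∇^i ∇_i b - |∇b|² / 2`: the identity
  -- is the conformal change of curvature under the factor `b⁻²`.
  simp only [riemann, pd_christoffel_gasMetric hI hF hp, christoffel_gasMetric hI hF hp,
    gasChristoffel, tailSpeed_eq, paramSum, Fin.sum_univ_three]
  have hb : b p ≠ 0 := hp.2
  have hf := hF.ne_zero hp 0
  have hφ := hF.ne_zero hp 1
  have hψ := hF.ne_zero hp 2
  have pairs : (k = 0 ∧ l = 1) ∨ (k = 0 ∧ l = 2) ∨ (k = 1 ∧ l = 2) := by omega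
  rcases pairs with ⟨rfl, rfl⟩ | ⟨rfl, rfl⟩ | ⟨rfl, rfl⟩ <;> fin_cases i <;> fin_cases j <;>
    simp [bCoeff] <;> field_simp <;> ring

end GasMetric

/-! ### Flatness criterion -/

section Flatness

variable {I : Fin 3 → Set ℝ} {F : Fin 3 → ℝ → ℝ} {p : Pt}

lemma exists_affine_of_deriv_eq {s : Set ℝ} (hs : IsOpen s) (hc : IsPreconnected s) {f : ℝ → ℝ}
    (hf : DifferentiableOn ℝ f s) {e : ℝ} (he : ∀ x ∈ s, deriv f x = e) :
    ∃ c, ∀ x ∈ s, f x = e * x + c := by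
  obtain ⟨c, hc⟩ := hs.exists_eq_add_of_deriv_eq hc hf
    (g := fun x => e * x) (by fun_prop) fun x hx => by simp [he x hx]
  exact ⟨c, hc⟩

lemma hasDerivAt_of_eqOn_affine {s : Set ℝ} (hs : IsOpen s) {f : ℝ → ℝ} {e c x : ℝ}
    (hf : ∀ y ∈ s, f y = e * y + c) (hx : x ∈ s) : HasDerivAt f e x := by
  have affine : HasDerivAt (fun y : ℝ => e * y + c) e x := by
    simpa using ((hasDerivAt_id x).const_mul e).add_const c
  exact affine.congr_of_eventuallyEq (eventually_of_mem (hs.mem_nhds hx) hf)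

lemma paramSum_of_affine {ε α β γ : ℝ} (h0 : α + β + 4 * γ = 0)
    (hf : F 0 (p 0) = ε * p 0 + α) (hφ : F 1 (p 1) = -ε * p 1 + β)
    (hψ : F 2 (p 2) = -(ε / 2) * p 2 + γ) : paramSum F p = -(ε / 2) * b p := by
  simp only [paramSum, Fin.sum_univ_three, hf, hφ, hψ, bCoeff, b, Matrix.cons_val]
  linear_combination (1 / 2) * h0

lemma IsFlatParam.tailSpeed_eq_zero (hI : ∀ i, IsOpen (I i)) (hF : IsFlatParam I F)
    (hp : p ∈ dom I) : tailSpeed F p = 0 := by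
  obtain ⟨ε, α, β, γ, h0, hf, hφ, hψ⟩ := hF
  have deriv_eq {i : Fin 3} {e c : ℝ} (h : ∀ s ∈ I i, F i s = e * s + c) :
      deriv (F i) (p i) = e := (hasDerivAt_of_eqOn_affine (hI i) h (hp.1 i)).deriv
  funext i
  rw [tailSpeed_eq, paramSum_of_affine h0 (hf _ (hp.1 0)) (hφ _ (hp.1 1)) (hψ _ (hp.1 2)),
    Pi.zero_apply]
  fin_cases i
  · simp [deriv_eq hf, bCoeff]; ring
  · simp [deriv_eq hφ, bCoeff]; ring
  · simp [deriv_eq hψ, bCoeff]; ring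

lemma bCoeff_mul_deriv_eq_of_tailSpeed_eq_zero (hI : ∀ i, IsOpen (I i))
    (hne : ∀ i, (I i).Nonempty) (h : ∀ p ∈ dom I, tailSpeed F p = 0) {i j : Fin 3} (hij : i ≠ j)
    {s t : ℝ} (hs : s ∈ I i) (ht : t ∈ I j) :
    bCoeff i * deriv (F i) s = bCoeff j * deriv (F j) t := by
  obtain ⟨p, hp, rfl, rfl⟩ := exists_mem_dom_pair hI hne hij hs ht
  have hi := congrFun (h p hp) i
  have hj := congrFun (h p hp) j
  rw [tailSpeed_eq, Pi.zero_apply] at hi hj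
  have hb : b p ≠ 0 := hp.2
  refine mul_left_cancel₀ (div_ne_zero hb two_ne_zero) ?_
  linarith

lemma isFlatParam_of_tailSpeed_eq_zero (hI : ∀ i, IsOpen (I i)) (hc : ∀ i, (I i).OrdConnected)
    (hne : ∀ i, (I i).Nonempty) (hF : IsParam I F) (h : ∀ p ∈ dom I, tailSpeed F p = 0) :
    IsFlatParam I F := by
  have deriv_relation {i j : Fin 3} (hij : i ≠ j) {s t : ℝ} (hs : s ∈ I i) (ht : t ∈ I j) :=
    bCoeff_mul_deriv_eq_of_tailSpeed_eq_zero hI hne h hij hs ht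
  obtain ⟨t, ht⟩ := hne 1
  obtain ⟨s, hs⟩ := hne 0
  have affine (i : Fin 3) (e : ℝ) (he : ∀ x ∈ I i, deriv (F i) x = e) :=
    exists_affine_of_deriv_eq (hI i) (hc i).isPreconnected
      (fun x hx => (hF.hasDerivAt hI hx).differentiableAt.differentiableWithinAt) he
  obtain ⟨α, hα⟩ := affine 0 (deriv (F 0) s) fun x hx => by
    have at_x := deriv_relation zero_ne_one hx ht
    have at_s := deriv_relation zero_ne_one hs ht
    simp only [bCoeff, Matrix.cons_val] at at_x at_s
    linarith
  obtain ⟨β, hβ⟩ := affine 1 (-deriv (F 0) s) fun x hx => by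
    have at_x := deriv_relation zero_ne_one hs hx
    simp only [bCoeff, Matrix.cons_val] at at_x
    linarith
  obtain ⟨γ, hγ⟩ := affine 2 (-(deriv (F 0) s / 2)) fun x hx => by
    have at_x := deriv_relation (show (0 : Fin 3) ≠ 2 by decide) hs hx
    simp only [bCoeff, Matrix.cons_val] at at_x
    linarith
  refine ⟨deriv (F 0) s, α, β, γ, ?_, hα, hβ, hγ⟩
  obtain ⟨p, hp, rfl⟩ := exists_mem_dom hI hne hs
  have first_speed := congrFun (h p hp) 0
  simp only [tailSpeed_eq, paramSum, Fin.sum_univ_three, hα _ (hp.1 0), hβ _ (hp.1 1),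
    hγ _ (hp.1 2), bCoeff, b, Matrix.cons_val, Pi.zero_apply] at first_speed
  linarith

lemma isFlatOn_gasMetric_iff (hI : ∀ i, IsOpen (I i)) (hc : ∀ i, (I i).OrdConnected)
    (hne : ∀ i, (I i).Nonempty) (hF : IsNondegParam I F) :
    IsFlatOn (gasMetric F) (dom I) ↔ IsFlatParam I F := by
  constructor
  · refine fun flat => isFlatParam_of_tailSpeed_eq_zero hI hc hne hF.1 fun p hp => ?_
    have add_eq_zero {i j : Fin 3} (hij : i ≠ j) : tailSpeed F p i + tailSpeed F p j = 0 := by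
      have riemann_eq_zero := flat p hp i j i j
      rw [riemann_gasMetric hI hF hp] at riemann_eq_zero
      have hb : b p ≠ 0 := hp.2
      simpa [hij, hb, hF.ne_zero hp j] using riemann_eq_zero
    have h01 := add_eq_zero (show (0 : Fin 3) ≠ 1 by decide)
    have h02 := add_eq_zero (show (0 : Fin 3) ≠ 2 by decide)
    have h12 := add_eq_zero (show (1 : Fin 3) ≠ 2 by decide)
    funext i
    rw [Pi.zero_apply]
    fin_cases i <;> simp only [Fin.zero_eta, Fin.mk_one, Fin.reduceFinMk] <;> linarith
  · intro h p hp i j k l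
    rw [riemann_gasMetric hI hF hp, h.tailSpeed_eq_zero hI hp]
    simp

end Flatness

/-! ### Densities of the system -/

section Densities

variable {I : Fin 3 → Set ℝ} {F : Fin 3 → ℝ → ℝ} {α β : ℝ → ℝ} {p : Pt}

/-- `α` solves `f α'' + ½ f' α' = 2` on `s`. In a coordinate `τ` with `dτ = ds / √|f|` this reads
`d²α/dτ² = ±2`, so that `± (∫ ds/√|f|)²` are solutions. -/
structure IsProfile (s : Set ℝ) (f α : ℝ → ℝ) : Prop where
  contDiffOn : ContDiffOn ℝ ∞ α s
  eq_two : ∀ x ∈ s, f x * deriv (deriv α) x + (1 / 2) * deriv f x * deriv α x = 2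

namespace IsProfile

variable {s : Set ℝ} {f : ℝ → ℝ} {x : ℝ}

lemma contDiffOn_deriv (h : IsProfile s f α) (hs : IsOpen s) : ContDiffOn ℝ ∞ (deriv α) s :=
  ((contDiffOn_infty_iff_deriv_of_isOpen hs).1 h.contDiffOn).2

lemma hasDerivAt (h : IsProfile s f α) (hs : IsOpen s) (hx : x ∈ s) :
    HasDerivAt α (deriv α x) x :=
  ((h.contDiffOn.contDiffAt (hs.mem_nhds hx)).differentiableAt (by simp)).hasDerivAt

lemma hasDerivAt_deriv (h : IsProfile s f α) (hs : IsOpen s) (hx : x ∈ s) :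
    HasDerivAt (deriv α) (deriv (deriv α) x) x :=
  (((h.contDiffOn_deriv hs).contDiffAt (hs.mem_nhds hx)).differentiableAt (by simp)).hasDerivAt

lemma of_hasDerivAt {α₁ α₂ : ℝ → ℝ} (hs : IsOpen s) (hα : ContDiffOn ℝ ∞ α s)
    (h₁ : ∀ x ∈ s, HasDerivAt α (α₁ x) x) (h₂ : ∀ x ∈ s, HasDerivAt α₁ (α₂ x) x)
    (h : ∀ x ∈ s, f x * α₂ x + (1 / 2) * deriv f x * α₁ x = 2) : IsProfile s f α where
  contDiffOn := hα
  eq_two x hx := by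
    have deriv_eq : deriv α =ᶠ[𝓝 x] α₁ :=
      eventually_of_mem (hs.mem_nhds hx) fun y hy => (h₁ y hy).deriv
    rw [deriv_eq.deriv_eq, (h₂ x hx).deriv, (h₁ x hx).deriv, h x hx]

end IsProfile

/-- The density `(ρ/8) (α(u) - β(v))`, where `ρ = 2/b`. -/
noncomputable def profileDensity (α β : ℝ → ℝ) (p : Pt) : ℝ :=
  (1 / 4) * ((α (p 0) - β (p 1)) * (b p)⁻¹)

/-- The transformed covector `b ∂h/∂u^k + a_k h` of the gradient of `h = profileDensity α β`. -/
noncomputable def hatGradient (α β : ℝ → ℝ) (p : Pt) : Pt :=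
  ![deriv α (p 0) / 4, -(deriv β (p 1) / 4), 0]

/-- A function `q` with `∂q/∂u^k = w^k ∂h/∂u^k` for `h = profileDensity α β`, that is, the value
of `(d/dx)⁻¹` on `w^k u^k_x ∂h/∂u^k`. -/
noncomputable def tailPotential (F : Fin 3 → ℝ → ℝ) (α β : ℝ → ℝ) (p : Pt) : ℝ :=
  (1 / 2) * (p 0 + p 1) - paramSum F p * profileDensity α β p
    - (1 / 4) * (F 0 (p 0) * deriv α (p 0) + F 1 (p 1) * deriv β (p 1))

lemma contDiffOn_comp_coord {f : ℝ → ℝ} {i : Fin 3} (hf : ContDiffOn ℝ ∞ f (I i)) :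
    ContDiffOn ℝ ∞ (fun q : Pt => f (q i)) (dom I) :=
  hf.comp (contDiff_apply ℝ ℝ i).contDiffOn fun _ hq => hq.1 i

lemma contDiffOn_profileDensity (hα : IsProfile (I 0) (F 0) α) (hβ : IsProfile (I 1) (F 1) β) :
    ContDiffOn ℝ ∞ (profileDensity α β) (dom I) :=
  contDiffOn_const.mul (((contDiffOn_comp_coord hα.contDiffOn).sub
    (contDiffOn_comp_coord hβ.contDiffOn)).mul (contDiff_b.contDiffOn.inv fun _ hq => hq.2))

lemma contDiffOn_tailPotential (hI : ∀ i, IsOpen (I i)) (hF : IsParam I F)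
    (hα : IsProfile (I 0) (F 0) α) (hβ : IsProfile (I 1) (F 1) β) :
    ContDiffOn ℝ ∞ (tailPotential F α β) (dom I) := by
  have contDiffOn_param := fun i => contDiffOn_comp_coord (hF i)
  have contDiffOn_paramSum : ContDiffOn ℝ ∞ (paramSum F) (dom I) :=
    contDiffOn_const.mul (ContDiffOn.sum fun i _ => contDiffOn_const.mul (contDiffOn_param i))
  have contDiffOn_coords : ContDiffOn ℝ ∞ (fun q : Pt => (1 / 2) * (q 0 + q 1)) (dom I) :=
    ContDiff.contDiffOn (by fun_prop)
  exact (contDiffOn_coords.sub (contDiffOn_paramSum.mul (contDiffOn_profileDensity hα hβ))).sub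
    (contDiffOn_const.mul
      (((contDiffOn_param 0).mul (contDiffOn_comp_coord (hα.contDiffOn_deriv (hI 0)))).add
        ((contDiffOn_param 1).mul (contDiffOn_comp_coord (hβ.contDiffOn_deriv (hI 1))))))

lemma hasPd_profileDensity (hI : ∀ i, IsOpen (I i)) (hα : IsProfile (I 0) (F 0) α)
    (hβ : IsProfile (I 1) (F 1) β) (hp : p ∈ dom I) :
    HasPd (profileDensity α β)
      (fun k => (hatGradient α β p k - bCoeff k * profileDensity α β p) / b p) p := by
  have hb : b p ≠ 0 := hp.2
  refine ((((HasPd.comp_coord (hα.hasDerivAt (hI 0) (hp.1 0))).sub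
    (HasPd.comp_coord (hβ.hasDerivAt (hI 1) (hp.1 1)))).mul (hasPd_b.inv hb)).const_mul
      (1 / 4)).congr fun k => ?_
  fin_cases k <;> simp [hatGradient, profileDensity] <;> field_simp <;> ring

lemma b_mul_pd_profileDensity_add (hI : ∀ i, IsOpen (I i)) (hα : IsProfile (I 0) (F 0) α)
    (hβ : IsProfile (I 1) (F 1) β) (hp : p ∈ dom I) (k : Fin 3) :
    b p * pd k (profileDensity α β) p + bCoeff k * profileDensity α β p = hatGradient α β p k := by
  rw [(hasPd_profileDensity hI hα hβ hp).pd_eq, mul_div_cancel₀ _ hp.2]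
  ring

lemma hasPd_paramSum (hI : ∀ i, IsOpen (I i)) (hF : IsParam I F) (hp : p ∈ dom I) :
    HasPd (paramSum F) (fun k => (1 / 2) * (bCoeff k ^ 2 * deriv (F k) (p k))) p := by
  have sum_eq : paramSum F = fun q => (1 / 2) * (bCoeff 0 ^ 2 * F 0 (q 0)
      + bCoeff 1 ^ 2 * F 1 (q 1) + bCoeff 2 ^ 2 * F 2 (q 2)) :=
    funext fun q => by rw [paramSum, Fin.sum_univ_three]
  rw [sum_eq]
  refine ((((hF.hasPd hI hp 0).const_mul (bCoeff 0 ^ 2)).add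
    ((hF.hasPd hI hp 1).const_mul (bCoeff 1 ^ 2))).add
    ((hF.hasPd hI hp 2).const_mul (bCoeff 2 ^ 2)) |>.const_mul (1 / 2)).congr fun k => ?_
  fin_cases k <;> simp

lemma pd_tailPotential (hI : ∀ i, IsOpen (I i)) (hF : IsParam I F)
    (hα : IsProfile (I 0) (F 0) α) (hβ : IsProfile (I 1) (F 1) β) (hp : p ∈ dom I) (k : Fin 3) :
    pd k (tailPotential F α β) p = tailSpeed F p k * pd k (profileDensity α β) p := by
  have gradient := hasPd_profileDensity hI hα hβ hp
  have hq : HasPd (tailPotential F α β) _ p :=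
    (((((HasPd.coord 0).add (HasPd.coord 1)).const_mul (1 / 2)).sub
      ((hasPd_paramSum hI hF hp).mul gradient)).sub
      ((((hF.hasPd hI hp 0).mul (HasPd.comp_coord (hα.hasDerivAt_deriv (hI 0) (hp.1 0)))).add
        ((hF.hasPd hI hp 1).mul
          (HasPd.comp_coord (hβ.hasDerivAt_deriv (hI 1) (hp.1 1))))).const_mul (1 / 4)))
  have hα₂ := hα.eq_two _ (hp.1 0)
  have hβ₂ := hβ.eq_two _ (hp.1 1)
  have hat_eq := b_mul_pd_profileDensity_add hI hα hβ hp k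
  rw [hq.pd_eq, tailSpeed_eq, ← gradient.pd_eq]
  fin_cases k <;> simp [bCoeff, hatGradient] at hat_eq ⊢
  · linear_combination (1 / 2) * deriv (F 0) (p 0) * hat_eq - (1 / 4) * hα₂
  · linear_combination (-1 / 2) * deriv (F 1) (p 1) * hat_eq - (1 / 4) * hβ₂
  · linear_combination -deriv (F 2) (p 2) * hat_eq

section AlongField

variable {u : ℝ → Pt}

/-- The derivative of `hatGradient α β` along the field `u`. -/
noncomputable def hatGradientDeriv (α β : ℝ → ℝ) (u : ℝ → Pt) (x : ℝ) : Pt :=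
  ![deriv (deriv α) (u x 0) * deriv u x 0 / 4, -(deriv (deriv β) (u x 1) * deriv u x 1 / 4), 0]

lemma hasDerivAt_hatGradient (hI : ∀ i, IsOpen (I i)) (hα : IsProfile (I 0) (F 0) α)
    (hβ : IsProfile (I 1) (F 1) β) (hu : IsField (dom I) u) (x : ℝ) (k : Fin 3) :
    HasDerivAt (fun y => hatGradient α β (u y) k) (hatGradientDeriv α β u x k) x := by
  have hα' := (hα.hasDerivAt_deriv (hI 0) ((hu.2 x).1 0)).comp x (hasDerivAt_component hu.1 0 x)
  have hβ' := (hβ.hasDerivAt_deriv (hI 1) ((hu.2 x).1 1)).comp x (hasDerivAt_component hu.1 1 x)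
  fin_cases k
  · exact hα'.div_const 4
  · exact (hβ'.div_const 4).neg
  · exact hasDerivAt_const x 0

lemma hasDerivAt_profileDensity_comp (hI : ∀ i, IsOpen (I i)) (hα : IsProfile (I 0) (F 0) α)
    (hβ : IsProfile (I 1) (F 1) β) (hu : IsField (dom I) u) (x : ℝ) :
    HasDerivAt (fun y => profileDensity α β (u y))
      (∑ k, deriv u x k * pd k (profileDensity α β) (u x)) x := by
  have gradient := hasPd_profileDensity hI hα hβ (hu.2 x)
  have hux : HasDerivAt u (deriv u x) x := ((contDiff_infty_iff_deriv.1 hu.1).1 x).hasDerivAt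
  exact (gradient.comp_curve hux).congr_deriv (Finset.sum_congr rfl fun k _ => by
    rw [gradient.pd_eq, mul_comm])

lemma differentiableAt_pd_profileDensity (hI : ∀ i, IsOpen (I i))
    (hα : IsProfile (I 0) (F 0) α) (hβ : IsProfile (I 1) (F 1) β) (hu : IsField (dom I) u) (x : ℝ)
    (k : Fin 3) : DifferentiableAt ℝ (fun y => pd k (profileDensity α β) (u y)) x := by
  rw [funext fun y => (hasPd_profileDensity hI hα hβ (hu.2 y)).pd_eq k]
  exact (((hasDerivAt_hatGradient hI hα hβ hu x k).sub
    ((hasDerivAt_profileDensity_comp hI hα hβ hu x).const_mul _)).div (hasDerivAt_b hu.1 x)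
      (hu.2 x).2).differentiableAt

lemma deriv_b_mul_pd_profileDensity_add (hI : ∀ i, IsOpen (I i))
    (hα : IsProfile (I 0) (F 0) α) (hβ : IsProfile (I 1) (F 1) β) (hu : IsField (dom I) u) (x : ℝ)
    (k : Fin 3) :
    b (deriv u x) * pd k (profileDensity α β) (u x)
        + b (u x) * deriv (fun y => pd k (profileDensity α β) (u y)) x
        + bCoeff k * ∑ j, deriv u x j * pd j (profileDensity α β) (u x)
      = hatGradientDeriv α β u x k := by
  have hsum := ((hasDerivAt_b hu.1 x).mul
    (differentiableAt_pd_profileDensity hI hα hβ hu x k).hasDerivAt).add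
    ((hasDerivAt_profileDensity_comp hI hα hβ hu x).const_mul (bCoeff k))
  exact (hsum.congr_of_eventuallyEq (Eventually.of_forall fun y =>
    (b_mul_pd_profileDensity_add hI hα hβ (hu.2 y) k).symm)).unique
    (hasDerivAt_hatGradient hI hα hβ hu x k)

lemma flow_speed_eq_act (hI : ∀ i, IsOpen (I i)) (hα : IsProfile (I 0) (F 0) α)
    (hβ : IsProfile (I 1) (F 1) β) (hu : IsField (dom I) u) (x : ℝ) (K : Fin 2 → ℝ → ℝ)
    (hK0 : K 0 x = profileDensity α β (u x)) (hK1 : K 1 x = tailPotential F α β (u x)) :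
    flow speed u x = (gasOp F).act u (fun y k => pd k (profileDensity α β) (u y)) K x := by
  have deriv_gradient : deriv (fun y k => pd k (profileDensity α β) (u y)) x
      = fun k => deriv (fun y => pd k (profileDensity α β) (u y)) x :=
    deriv_pi fun k => differentiableAt_pd_profileDensity hI hα hβ hu x k
  have hα₂ := hα.eq_two _ ((hu.2 x).1 0)
  have hβ₂ := hβ.eq_two _ ((hu.2 x).1 1)
  funext i
  rw [act_gasOp, deriv_gradient, hK0, hK1]
  simp only [b_mul_pd_profileDensity_add hI hα hβ (hu.2 x),
    deriv_b_mul_pd_profileDensity_add hI hα hβ hu, tailPotential, flow]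
  fin_cases i <;>
    simp [hatGradient, hatGradientDeriv, bCoeff, Fin.sum_univ_three, speed, b]
  · linear_combination -(1 / 4) * (2 * u x 2 + u x 1 - u x 0) * deriv u x 0 * hα₂
  · linear_combination (1 / 4) * (2 * u x 2 + u x 1 - u x 0) * deriv u x 1 * hβ₂
  · ring

end AlongField

lemma isHamiltonianSystem_gasOp (hI : ∀ i, IsOpen (I i)) (hF : IsParam I F)
    (hα : IsProfile (I 0) (F 0) α) (hβ : IsProfile (I 1) (F 1) β) :
    IsHamiltonianSystem (dom I) speed (gasOp F) (profileDensity α β) := by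
  let q : Fin 2 → Pt → ℝ := ![profileDensity α β, tailPotential F α β]
  have hq : ∀ m : Fin 2, ContDiffOn ℝ ∞ (q m) (dom I) ∧ ∀ p ∈ dom I, ∀ k,
      pd k (q m) p = (gasOp F).right m p k * pd k (profileDensity α β) p :=
    Fin.forall_fin_two.2
      ⟨⟨contDiffOn_profileDensity hα hβ, fun p _ k => (one_mul _).symm⟩,
        contDiffOn_tailPotential hI hF hα hβ, fun p hp k => pd_tailPotential hI hF hα hβ hp k⟩
  exact ⟨contDiffOn_profileDensity hα hβ, q, hq,
    fun u hu x => flow_speed_eq_act hI hα hβ hu x _ rfl rfl⟩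

end Densities

lemma isHamiltonianSystem_congr {D : Set Pt} {V : Pt → Pt} {J : HydroOp} {g h : Pt → ℝ}
    (hD : IsOpen D) (hh : IsHamiltonianSystem D V J h) (hgh : Set.EqOn g h D) :
    IsHamiltonianSystem D V J g := by
  obtain ⟨smooth, q, hq, hflow⟩ := hh
  have pd_eq {p : Pt} (hp : p ∈ D) (k : Fin 3) : pd k g p = pd k h p :=
    pd_congr (eventually_of_mem (hD.mem_nhds hp) hgh) k
  refine ⟨smooth.congr hgh, q, fun m => ⟨(hq m).1, fun p hp k => ?_⟩, fun u hu x => ?_⟩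
  · rw [pd_eq hp, (hq m).2 p hp k]
  · rw [hflow u hu x, funext fun y => funext fun k => pd_eq (hu.2 y) k]

section GasDensity

variable {s : Set ℝ} {f A : ℝ → ℝ} {σ : ℝ}

lemma exists_sign_eq (hs : IsPreconnected s) (hf : ContinuousOn f s) (h0 : ∀ x ∈ s, f x ≠ 0) :
    ∃ σ : ℝ, σ ^ 2 = 1 ∧ ∀ x ∈ s, Real.sign (f x) = σ ∧ |f x| = σ * f x := by
  by_cases h : ∃ y ∈ s, 0 < f y
  · obtain ⟨y, hy, hfy⟩ := h
    refine ⟨1, by norm_num, fun x hx => ?_⟩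
    have pos : 0 < f x := by
      by_contra nonpos
      obtain ⟨z, hz, hz0⟩ := hs.intermediate_value hx hy hf
        (⟨not_lt.1 nonpos, hfy.le⟩ : (0 : ℝ) ∈ Set.Icc (f x) (f y))
      exact h0 z hz hz0
    rw [Real.sign_of_pos pos, abs_of_pos pos, one_mul]
    exact ⟨rfl, rfl⟩
  · refine ⟨-1, by norm_num, fun x hx => ?_⟩
    have neg : f x < 0 := lt_of_le_of_ne (not_lt.1 fun pos => h ⟨x, hx, pos⟩) (h0 x hx)
    rw [Real.sign_of_neg neg, abs_of_neg neg, neg_one_mul]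
    exact ⟨rfl, rfl⟩

lemma contDiffOn_of_hasDerivAt_one_div_sqrt {g : ℝ → ℝ} (hs : IsOpen s) (hg : ContDiffOn ℝ ∞ g s)
    (hpos : ∀ x ∈ s, 0 < g x) (hA : ∀ x ∈ s, HasDerivAt A (1 / √(g x)) x) :
    ContDiffOn ℝ ∞ A s := by
  rw [contDiffOn_infty_iff_deriv_of_isOpen hs]
  refine ⟨fun x hx => (hA x hx).differentiableAt.differentiableWithinAt, ?_⟩
  exact (contDiffOn_const.div (hg.sqrt fun x hx => (hpos x hx).ne')
    fun x hx => (Real.sqrt_pos.2 (hpos x hx)).ne').congr fun x hx => (hA x hx).deriv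

lemma isProfile_mul_sq (hs : IsOpen s) (hσ : σ ^ 2 = 1) (hf : ContDiffOn ℝ ∞ f s)
    (hpos : ∀ x ∈ s, 0 < σ * f x) (hA : ∀ x ∈ s, HasDerivAt A (1 / √(σ * f x)) x) :
    IsProfile s f fun x => σ * A x ^ 2 := by
  have smooth := contDiffOn_of_hasDerivAt_one_div_sqrt hs (contDiffOn_const.mul hf) hpos hA
  have hasDerivAt_f {x : ℝ} (hx : x ∈ s) : HasDerivAt f (deriv f x) x :=
    ((hf.contDiffAt (hs.mem_nhds hx)).differentiableAt (by simp)).hasDerivAt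
  have sqrt_pos {x : ℝ} (hx : x ∈ s) : 0 < √(σ * f x) := Real.sqrt_pos.2 (hpos x hx)
  refine .of_hasDerivAt (α₁ := fun x => 2 * σ * (A x * (√(σ * f x))⁻¹)) hs
    (contDiffOn_const.mul (smooth.pow 2))
    (fun x hx => (((hA x hx).pow 2).const_mul σ).congr_deriv (by simp; ring))
    (fun x hx => ((hA x hx).mul ((((hasDerivAt_f hx).const_mul σ).sqrt (hpos x hx).ne').inv
      (sqrt_pos hx).ne')).const_mul (2 * σ)) fun x hx => ?_
  have f_eq : f x = σ * √(σ * f x) ^ 2 := by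
    rw [Real.sq_sqrt (hpos x hx).le, ← mul_assoc, ← sq, hσ, one_mul]
  have hr := sqrt_pos hx
  simp only [Pi.inv_apply]
  generalize √(σ * f x) = r at *
  rw [f_eq]
  field_simp
  linear_combination (2 * r - σ * A x * deriv f x) * hσ

lemma isHamiltonianSystem_gasDensity {I : Fin 3 → Set ℝ} {F : Fin 3 → ℝ → ℝ} {A B : ℝ → ℝ}
    (hI : ∀ i, IsOpen (I i)) (hc : ∀ i, (I i).OrdConnected) (hF : IsNondegParam I F)
    (hA : ∀ s ∈ I 0, HasDerivAt A (1 / √|F 0 s|) s)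
    (hB : ∀ s ∈ I 1, HasDerivAt B (1 / √|F 1 s|) s) :
    IsHamiltonianSystem (dom I) speed (gasOp F) (gasDensity F A B) := by
  have exists_profile {i : Fin 3} {C : ℝ → ℝ} (hC : ∀ s ∈ I i, HasDerivAt C (1 / √|F i s|) s) :
      ∃ σ : ℝ, (∀ s ∈ I i, Real.sign (F i s) = σ) ∧
        IsProfile (I i) (F i) fun s => σ * C s ^ 2 := by
    obtain ⟨σ, hσ, hσF⟩ :=
      exists_sign_eq (hc i).isPreconnected (hF.1 i).continuousOn (hF.2 i)
    exact ⟨σ, fun s hs => (hσF s hs).1, isProfile_mul_sq (hI i) hσ (hF.1 i)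
      (fun s hs => (hσF s hs).2 ▸ abs_pos.2 (hF.2 i s hs)) fun s hs => (hσF s hs).2 ▸ hC s hs⟩
  obtain ⟨σ, hσ, hα⟩ := exists_profile hA
  obtain ⟨τ, hτ, hβ⟩ := exists_profile hB
  refine isHamiltonianSystem_congr (isOpen_dom hI) (isHamiltonianSystem_gasOp hI hF.1 hα hβ)
    fun q hq => ?_
  rw [gasDensity, profileDensity, hσ _ (hq.1 0), hτ _ (hq.1 1)]
  ring

end GasDensity

/-! ### The local operators -/

section LocalPart

variable {I : Fin 3 → Set ℝ} {F : Fin 3 → ℝ → ℝ} {α β : ℝ → ℝ}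

lemma act_gasOp_eq_localPart (F : Fin 3 → ℝ → ℝ) (u ξ : ℝ → Pt) (K : Fin 2 → ℝ → ℝ)
    (K' : Fin 0 → ℝ → ℝ) (x : ℝ) (i : Fin 3) :
    (gasOp F).act u ξ K x i = (gasOp F).localPart.act u ξ K' x i
      + (tailSpeed F (u x) i * deriv u x i * K 0 x + deriv u x i * K 1 x) := by
  have local_sum : ∀ g : Fin (gasOp F).localPart.N → ℝ, ∑ m, g m = 0 := fun g =>
    Finset.sum_eq_zero fun m _ => Fin.elim0 m
  have tail_sum : ∀ g : Fin (gasOp F).N → ℝ, ∑ m, g m = g (0 : Fin 2) + g (1 : Fin 2) :=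
    Fin.sum_univ_two
  unfold HydroOp.act
  rw [local_sum, tail_sum, add_zero]
  simp [gasOp, HydroOp.localPart]

lemma represents_localPart (hw : ∀ p ∈ dom I, tailSpeed F p = 0) :
    Represents I (gasOp F).localPart.toOp F := by
  intro u ξ _ _ hD x hx
  have integrand_eq_zero : (fun y => ∑ j, tailSpeed F (u y) j * deriv u y j * ξ y j) = 0 := by
    funext y
    by_cases hy : y ∈ tsupport ξ
    · simp [hw _ (hD y hy)]
    · simp [image_eq_zero_of_notMem_tsupport hy]
  have weightedMomentum_eq_zero : weightedMomentum F u ξ x = 0 := by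
    rw [weightedMomentum, integrand_eq_zero]
    simp [Dinv]
  funext i
  rw [toOp_gasOp_eq_act, act_gasOp_eq_localPart F u ξ _ fun m => Fin.elim0 m, hw _ hx]
  simp only [Matrix.cons_val, weightedMomentum_eq_zero, Pi.zero_apply, zero_mul, mul_zero,
    add_zero]
  unfold HydroOp.toOp
  congr 2
  funext m
  exact Fin.elim0 m

lemma isHamiltonianSystem_localPart (hI : ∀ i, IsOpen (I i)) (hα : IsProfile (I 0) (F 0) α)
    (hβ : IsProfile (I 1) (F 1) β) (hw : ∀ p ∈ dom I, tailSpeed F p = 0)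
    (hq : ∀ p ∈ dom I, tailPotential F α β p = 0) :
    IsHamiltonianSystem (dom I) speed (gasOp F).localPart (profileDensity α β) := by
  refine ⟨contDiffOn_profileDensity hα hβ, fun _ _ => 0, fun m => Fin.elim0 m, fun u hu x => ?_⟩
  rw [flow_speed_eq_act hI hα hβ hu x ![fun y => profileDensity α β (u y), fun _ => 0] rfl
    (hq _ (hu.2 x)).symm]
  funext i
  rw [act_gasOp_eq_localPart F u _ _ (fun m => Fin.elim0 m), hw _ (hu.2 x)]
  simp only [Matrix.cons_val, Pi.zero_apply, zero_mul, mul_zero, add_zero]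
  rfl

lemma isProfile_sq_div {s : Set ℝ} {f : ℝ → ℝ} {c : ℝ} (hs : IsOpen s) (hc : c ≠ 0)
    (hf : ∀ x ∈ s, f x = 0 * x + c) : IsProfile s f fun x => x ^ 2 / c :=
  .of_hasDerivAt (α₂ := fun _ => 2 / c) hs (ContDiff.contDiffOn (by fun_prop))
    (fun x _ => ((hasDerivAt_pow 2 x).div_const c).congr_deriv (by simp))
    (fun x _ => (((hasDerivAt_id x).const_mul 2).div_const c).congr_deriv (by simp))
    fun x hx => by
      rw [(hasDerivAt_of_eqOn_affine hs hf hx).deriv, hf x hx]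
      field_simp
      ring

lemma isProfile_affine {s : Set ℝ} {f : ℝ → ℝ} {e c : ℝ} (hs : IsOpen s) (he : e ≠ 0)
    (hf : ∀ x ∈ s, f x = e * x + c) (k : ℝ) : IsProfile s f fun x => 4 / e * x + k :=
  .of_hasDerivAt hs (ContDiff.contDiffOn (by fun_prop))
    (fun x hx => hasDerivAt_of_eqOn_affine hs (fun _ _ => rfl) hx)
    (fun x _ => hasDerivAt_const x _)
    fun x hx => by
      rw [(hasDerivAt_of_eqOn_affine hs hf hx).deriv]
      field_simp
      ring

lemma IsFlatParam.exists_localDensity (hI : ∀ i, IsOpen (I i)) (hne : ∀ i, (I i).Nonempty)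
    (hF : IsNondegParam I F) (hflat : IsFlatParam I F) :
    ∃ h, IsHamiltonianSystem (dom I) speed (gasOp F).localPart h := by
  have hw : ∀ p ∈ dom I, tailSpeed F p = 0 := fun p => hflat.tailSpeed_eq_zero hI
  obtain ⟨ε, α, β, γ, h0, hf, hφ, hψ⟩ := hflat
  have paramSum_eq {p : Pt} (hp : p ∈ dom I) : paramSum F p = -(ε / 2) * b p :=
    paramSum_of_affine h0 (hf _ (hp.1 0)) (hφ _ (hp.1 1)) (hψ _ (hp.1 2))
  rcases eq_or_ne ε 0 with rfl | hε
  · rw [neg_zero] at hφ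
    have const_ne_zero {i : Fin 3} {c : ℝ} (h : ∀ s ∈ I i, F i s = 0 * s + c) : c ≠ 0 := by
      obtain ⟨s, hs⟩ := hne i
      simpa [h s hs] using hF.2 i s hs
    have hα := const_ne_zero hf
    have hβ := const_ne_zero hφ
    refine ⟨_, isHamiltonianSystem_localPart hI (isProfile_sq_div (hI 0) hα hf)
      (isProfile_sq_div (hI 1) hβ hφ) hw fun p hp => ?_⟩
    rw [tailPotential, paramSum_eq hp, hf _ (hp.1 0), hφ _ (hp.1 1)]
    simp only [deriv_div_const, deriv_fun_pow, differentiableAt_fun_id, deriv_id'']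
    field_simp
    ring
  · refine ⟨_, isHamiltonianSystem_localPart hI
      (isProfile_affine (hI 0) hε hf (8 * (α - β) / ε ^ 2))
      (isProfile_affine (hI 1) (neg_ne_zero.2 hε) hφ 0) hw fun p hp => ?_⟩
    have hb : b p ≠ 0 := hp.2
    rw [tailPotential, profileDensity, paramSum_eq hp, hf _ (hp.1 0), hφ _ (hp.1 1)]
    simp only [deriv_add_const', deriv_const_mul_id']
    field_simp
    ring

end LocalPart

/-! ### Nonflat metrics and the three local operators -/

section Examples

variable {I : Fin 3 → Set ℝ}

lemma eq_zero_of_forall_mul_add_eq_const {s : Set ℝ} (hs : IsOpen s) (hne : s.Nonempty)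
    {a c k : ℝ} (h : ∀ x ∈ s, a * x + c = k) : a = 0 := by
  obtain ⟨x, hx⟩ := hne
  obtain ⟨t, ht, htx⟩ := exists_mem_ne_of_isOpen hs hx
  exact (mul_eq_zero.1 (by linear_combination h t ht - h x hx : a * (t - x) = 0)).resolve_right
    (sub_ne_zero.2 htx)

lemma not_isFlatParam_const (hI : ∀ i, IsOpen (I i)) (hne : ∀ i, (I i).Nonempty) {k : ℝ}
    (hk : k ≠ 0) : ¬ IsFlatParam I fun _ _ => k := by
  rintro ⟨ε, α, β, γ, h0, hf, hφ, hψ⟩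
  obtain rfl := eq_zero_of_forall_mul_add_eq_const (hI 0) (hne 0) fun x hx => (hf x hx).symm
  obtain ⟨s, hs⟩ := hne 0
  obtain ⟨t, ht⟩ := hne 1
  obtain ⟨r, hr⟩ := hne 2
  exact hk (by linear_combination (hf s hs + hφ t ht + 4 * hψ r hr + h0) / 6)

lemma infinite_nonflat (hI : ∀ i, IsOpen (I i)) (hc : ∀ i, (I i).OrdConnected)
    (hne : ∀ i, (I i).Nonempty) :
    {T | ∃ F, IsNondegParam I F ∧ ¬ IsFlatOn (gasMetric F) (dom I) ∧
      T = restrict (dom I) (gasOp F).toOp}.Infinite := by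
  have succ_ne_zero (n : ℕ) : (n : ℝ) + 1 ≠ 0 := n.cast_add_one_ne_zero
  have isNondegParam_succ (n : ℕ) : IsNondegParam I fun _ _ => (n : ℝ) + 1 :=
    ⟨fun _ => contDiffOn_const, fun _ _ _ => succ_ne_zero n⟩
  refine Set.infinite_of_injective_forall_mem
    (f := fun n : ℕ => restrict (dom I) (gasOp fun _ _ => (n : ℝ) + 1).toOp)
    (fun m n hmn => ?_) fun n => ⟨_, isNondegParam_succ n, fun hflat => ?_, rfl⟩
  · obtain ⟨s, hs⟩ := hne 0
    exact Nat.cast_injective (add_right_cancel (eqOn_of_restrict_eq hI hne hmn 0 hs))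
  · exact not_isFlatParam_const hI hne (succ_ne_zero n)
      ((isFlatOn_gasMetric_iff hI hc hne (isNondegParam_succ n)).1 hflat)

/-- The parameters `(f, φ, ψ)` of a flat metric with given constants `ε, α, β`; the constant `γ` is
determined by `α + β + 4 γ = 0`. -/
noncomputable def flatParam (ε α β : ℝ) : Fin 3 → ℝ → ℝ :=
  ![fun s => ε * s + α, fun s => -ε * s + β, fun s => -(ε / 2) * s + -(α + β) / 4]

lemma isParam_flatParam (ε α β : ℝ) : IsParam I (flatParam ε α β) := by
  have contDiffOn_affine (a c : ℝ) (i : Fin 3) : ContDiffOn ℝ ∞ (fun s => a * s + c) (I i) := by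
    fun_prop
  intro i
  fin_cases i <;> exact contDiffOn_affine _ _ _

lemma isFlatParam_flatParam (ε α β : ℝ) : IsFlatParam I (flatParam ε α β) :=
  ⟨ε, α, β, -(α + β) / 4, by ring, fun _ _ => rfl, fun _ _ => rfl, fun _ _ => rfl⟩

lemma IsFlatParam.exists_eqOn_flatParam {F : Fin 3 → ℝ → ℝ} (hF : IsFlatParam I F) :
    ∃ ε α β : ℝ, ∀ i, Set.EqOn (F i) (flatParam ε α β i) (I i) := by
  obtain ⟨ε, α, β, γ, h0, hf, hφ, hψ⟩ := hF
  obtain rfl : γ = -(α + β) / 4 := by linarith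
  exact ⟨ε, α, β, Fin.forall_fin_succ.2 ⟨hf, Fin.forall_fin_two.2 ⟨hφ, hψ⟩⟩⟩

lemma exists_forall_abs_lt {ι : Type*} [Finite ι] {s : ι → Set ℝ}
    (hs : ∀ i, Bornology.IsBounded (s i)) : ∃ N : ℝ, ∀ i, ∀ x ∈ s i, |x| < N := by
  obtain ⟨N, hN⟩ := (Bornology.isBounded_iUnion.2 hs).subset_ball (0 : ℝ)
  exact ⟨N, fun i x hx => by simpa using hN (Set.mem_iUnion_of_mem i hx)⟩

/-- Three linearly independent parameters of flat metrics. For `N` exceeding the absolute values of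
all points of the intervals, none of their components has a zero. -/
noncomputable def localBasis (N : ℝ) : Fin 3 → Fin 3 → ℝ → ℝ :=
  ![flatParam 0 1 (-5), flatParam 0 1 3, flatParam 1 N (3 * N)]

lemma isFlatParam_localBasis (N : ℝ) (m : Fin 3) : IsFlatParam I (localBasis N m) := by
  fin_cases m <;> exact isFlatParam_flatParam _ _ _

lemma isParam_localBasis (N : ℝ) (m : Fin 3) : IsParam I (localBasis N m) := by
  fin_cases m <;> exact isParam_flatParam _ _ _

lemma isNondegParam_localBasis {N : ℝ} (hN : ∀ i, ∀ x ∈ I i, |x| < N) (m : Fin 3) :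
    IsNondegParam I (localBasis N m) := by
  refine ⟨isParam_localBasis N m, fun i x hx hzero => ?_⟩
  have hx' := abs_lt.1 (hN i x hx)
  fin_cases m <;> fin_cases i <;> simp [localBasis, flatParam] at hzero <;> linarith

section Span

variable {N : ℝ} {c : Fin 3 → ℝ}

lemma sum_mul_localBasis (N : ℝ) (c : Fin 3 → ℝ) :
    (fun i s => ∑ m, c m * localBasis N m i s) =
      flatParam (c 2) (c 0 + c 1 + c 2 * N) (-5 * c 0 + 3 * c 1 + 3 * c 2 * N) := by
  funext i s
  fin_cases i <;> simp [Fin.sum_univ_three, localBasis, flatParam] <;> ring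

lemma restrict_gasOp_eq_sum (hI : ∀ i, IsOpen (I i)) {F : Fin 3 → ℝ → ℝ}
    (hF : ∀ i, Set.EqOn (F i) (fun s => ∑ m, c m * localBasis N m i s) (I i)) :
    restrict (dom I) (gasOp F).toOp =
      ∑ m, c m • restrict (dom I) (gasOp (localBasis N m)).toOp := by
  rw [sum_smul_restrict]
  exact (represents_sum hI (isParam_localBasis N) hF).restrict_eq.symm

lemma linearIndependent_localBasis (hI : ∀ i, IsOpen (I i)) (hne : ∀ i, (I i).Nonempty) (N : ℝ) :
    LinearIndependent ℝ fun m => restrict (dom I) (gasOp (localBasis N m)).toOp := by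
  rw [Fintype.linearIndependent_iff]
  intro c hsum
  have restrict_eq : restrict (dom I) (gasOp fun i s => ∑ m, c m * localBasis N m i s).toOp =
      restrict (dom I) (gasOp fun _ _ => 0).toOp := by
    rw [restrict_gasOp_eq_sum hI fun i s _ => rfl, hsum,
      restrict_gasOp_eq_sum (N := N) (c := 0) hI fun i s _ => by simp]
    simp only [Pi.zero_apply, zero_smul, Finset.sum_const_zero]
  rw [sum_mul_localBasis] at restrict_eq
  have eqOn_zero := eqOn_of_restrict_eq hI hne restrict_eq
  have hc₂ : c 2 = 0 := eq_zero_of_forall_mul_add_eq_const (hI 0) (hne 0) (eqOn_zero 0)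
  obtain ⟨s, hs⟩ := hne 0
  obtain ⟨t, ht⟩ := hne 1
  have hα : c 2 * s + (c 0 + c 1 + c 2 * N) = 0 := eqOn_zero 0 hs
  have hβ : -c 2 * t + (-5 * c 0 + 3 * c 1 + 3 * c 2 * N) = 0 := eqOn_zero 1 ht
  rw [hc₂] at hα hβ
  have hc₀ : c 0 = 0 := by linarith
  have hc₁ : c 1 = 0 := by linarith
  exact Fin.forall_fin_succ.2 ⟨hc₀, Fin.forall_fin_two.2 ⟨hc₁, hc₂⟩⟩

lemma IsFlatParam.restrict_mem_span (hI : ∀ i, IsOpen (I i)) {F : Fin 3 → ℝ → ℝ}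
    (hF : IsFlatParam I F) (N : ℝ) :
    restrict (dom I) (gasOp F).toOp ∈
      Submodule.span ℝ (Set.range fun m => restrict (dom I) (gasOp (localBasis N m)).toOp) := by
  obtain ⟨ε, α, β, eqOn⟩ := hF.exists_eqOn_flatParam
  let c : Fin 3 → ℝ := ![(3 * α - β) / 8, (5 * α + β) / 8 - ε * N, ε]
  have sum_eq : (fun i s => ∑ m, c m * localBasis N m i s) = flatParam ε α β := by
    rw [sum_mul_localBasis]
    congr 1 <;> simp only [c, Matrix.cons_val] <;> ring
  rw [restrict_gasOp_eq_sum (c := c) hI fun i s hs =>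
    (eqOn i hs).trans (congrFun (congrFun sum_eq i) s).symm]
  exact Submodule.sum_mem _ fun m _ => Submodule.smul_mem _ _ (Submodule.subset_span ⟨m, rfl⟩)

end Span

lemma exists_localBasis (hI : ∀ i, IsOpen (I i)) (hc : ∀ i, (I i).OrdConnected)
    (hne : ∀ i, (I i).Nonempty) (hbd : ∀ i, Bornology.IsBounded (I i)) :
    ∃ G : Fin 3 → Fin 3 → ℝ → ℝ,
      (∀ m, IsNondegParam I (G m) ∧ IsFlatOn (gasMetric (G m)) (dom I)) ∧
      LinearIndependent ℝ (fun m => restrict (dom I) (gasOp (G m)).toOp) ∧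
      ∀ F, IsNondegParam I F → IsFlatOn (gasMetric F) (dom I) →
        restrict (dom I) (gasOp F).toOp ∈
          Submodule.span ℝ (Set.range fun m => restrict (dom I) (gasOp (G m)).toOp) := by
  obtain ⟨N, hN⟩ := exists_forall_abs_lt hbd
  have hG := isNondegParam_localBasis hN
  exact ⟨localBasis N,
    fun m => ⟨hG m, (isFlatOn_gasMetric_iff hI hc hne (hG m)).2 (isFlatParam_localBasis N m)⟩,
    linearIndependent_localBasis hI hne N,
    fun F hF hflat => ((isFlatOn_gasMetric_iff hI hc hne hF).1 hflat).restrict_mem_span hI N⟩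

end Examples

end HydroType

theorem mainTheorem8 (I : Fin 3 → Set ℝ) (hopen : ∀ i, IsOpen (I i))
    (hint : ∀ i, (I i).OrdConnected) (hne : ∀ i, (I i).Nonempty) :
    -- the system is gas dynamics with `P = s - 1/ρ` in Riemann invariants
    (∀ (ρ c s : ℝ × ℝ → ℝ) (z : ℝ × ℝ), DifferentiableAt ℝ ρ z → DifferentiableAt ℝ c z →
      DifferentiableAt ℝ s z → ρ z ≠ 0 →
      (GasEquations ρ c s z ↔
        RiemannEquations ![fun y => -c y + s y - 1 / ρ y, fun y => -c y - s y + 1 / ρ y, s] z)) ∧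
    -- the operators are Hamiltonian, and the tail consists of commuting flows
    (∀ F, IsParam I F → IsHamiltonian (dom I) (gasOp F).toOp ∧
      FlowsCommute (dom I) speed (tailSpeed F)) ∧
    -- they are mutually compatible
    (∀ F G, IsParam I F → IsParam I G →
      AreCompatible (dom I) (gasOp F).toOp (gasOp G).toOp) ∧
    -- different parameters give different operators
    (∀ F G, IsParam I F → IsParam I G →
      restrict (dom I) (gasOp F).toOp = restrict (dom I) (gasOp G).toOp →
      ∀ i, Set.EqOn (F i) (G i) (I i)) ∧
    -- infinitely many of them have a nondegenerate metric that is not flat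
    {T | ∃ F, IsNondegParam I F ∧ ¬ IsFlatOn (gasMetric F) (dom I) ∧
      T = restrict (dom I) (gasOp F).toOp}.Infinite ∧
    (∀ F, IsNondegParam I F →
      -- the local part is generated by the metric, which is conformally flat
      (gasOp F).IsGeneratedBy (gasMetric F) (dom I) ∧
      IsConformallyFlatOn (gasMetric F) (dom I) ∧
      -- the system is Hamiltonian with the stated density
      (∀ A B : ℝ → ℝ, (∀ s ∈ I 0, HasDerivAt A (1 / √|F 0 s|) s) →
        (∀ s ∈ I 1, HasDerivAt B (1 / √|F 1 s|) s) →
        IsHamiltonianSystem (dom I) speed (gasOp F) (gasDensity F A B)) ∧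
      -- criterion of flatness
      (IsFlatOn (gasMetric F) (dom I) ↔ IsFlatParam I F) ∧
      -- in the flat case the operator is local and the system has a local Hamiltonian structure
      (IsFlatOn (gasMetric F) (dom I) →
        (∀ p ∈ dom I, tailSpeed F p = 0) ∧
        restrict (dom I) (gasOp F).toOp = restrict (dom I) (gasOp F).localPart.toOp ∧
        IsHamiltonian (dom I) (gasOp F).localPart.toOp ∧
        ∃ h, IsHamiltonianSystem (dom I) speed (gasOp F).localPart h)) ∧
    -- there are exactly three linearly independent local structures
    ((∀ i, Bornology.IsBounded (I i)) → ∃ G : Fin 3 → Fin 3 → ℝ → ℝ,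
      (∀ m, IsNondegParam I (G m) ∧ IsFlatOn (gasMetric (G m)) (dom I)) ∧
      LinearIndependent ℝ (fun m => restrict (dom I) (gasOp (G m)).toOp) ∧
      ∀ F, IsNondegParam I F → IsFlatOn (gasMetric F) (dom I) →
        restrict (dom I) (gasOp F).toOp ∈
          Submodule.span ℝ (Set.range fun m => restrict (dom I) (gasOp (G m)).toOp)) := by
  refine ⟨fun ρ c s z => gasEquations_iff,
    fun F hF => ⟨(represents_gasOp F).isHamiltonian hopen hF, flowsCommute_tailSpeed hopen hF⟩,
    fun F G => areCompatible_gasOp hopen,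
    fun F G _ _ h => eqOn_of_restrict_eq hopen hne h,
    infinite_nonflat hopen hint hne,
    fun F hF => ⟨isGeneratedBy_gasMetric hopen hF, isConformallyFlatOn_gasMetric hopen hF,
      fun A B => isHamiltonianSystem_gasDensity hopen hint hF,
      isFlatOn_gasMetric_iff hopen hint hne hF, fun hflat => ?_⟩,
    exists_localBasis hopen hint hne⟩
  have isFlatParam := (isFlatOn_gasMetric_iff hopen hint hne hF).1 hflat
  have tailSpeed_eq_zero : ∀ p ∈ dom I, tailSpeed F p = 0 := fun p =>
    isFlatParam.tailSpeed_eq_zero hopen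
  have represents := represents_localPart tailSpeed_eq_zero
  exact ⟨tailSpeed_eq_zero, represents.restrict_eq.symm, represents.isHamiltonian hopen hF.1,
    isFlatParam.exists_localDensity hopen hne hF⟩
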